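/- Let $f:\mathbb R\to\mathbb R$ be Lipschitz and $1$-periodic, exactly so in the sense that, whenever $\theta\not\equiv\theta' \pmod 1$, the functions $f(\cdot-\theta)$ and $f(\cdot-\theta')$ differ on a subset of $[0,1]$ of positive measure. Let $\phi$ be a bounded, even probability density on $\mathbb R$, with distribution function $\Phi$, and put $\Phi_2(t)=\int_{\mathbb R}\Phi(t+z)\phi(z)\,dz$. For $\theta^*\in\mathbb R$ and $n\ge 1$ let $P_{n,\theta^*}$ be the law of $(Y_1,\dots,Y_n)$, where $$Y_i=f(i/n-\theta^*)+Z_i,\qquad Z_1,\dots,Z_n \text{ iid with density } \phi .$$ Assume that for every $\theta^*$ the function $$M(\theta)=\int_0^1\!\int_0^1\Phi_2(f(x_0)-f(x))\,f(x_0+\theta^*-\theta)\,dx\,dx_0$$ has, modulo $1$, the unique maximum point $\theta^*$. Let $d(\theta,\theta')=\min_{k\in\mathbb Z}|\theta-\theta'-k|$. An R-estimator is any choice $$\hat\theta_n\in\operatorname*{arg\,max}_{\theta\in\mathbb R}\sum_{i=1}^nR_i\,f(i/n-\theta),\qquad R_i=\#\{j: Y_j\le Y_i\}.$$ Then the R-estimator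 achieves the minimax rate of convergence $\sqrt n$ for estimating the shift $\theta^*$: 1. (The rate is achieved.) For every R-estimator and every $\varepsilon>0$ there is $K$ such that for all $n\ge1$ $$\sup_{\theta^*\in\mathbb R}P_{n,\theta^*}\big(\sqrt n\,d(\hat\theta_n,\theta^*)>K\big)\le\varepsilon .$$ 2. (No estimator does better.) If the noise has finite Fisher information for location, that is, $\phi$ is locally absolutely continuous and $\int(\phi')^2/\phi<\infty$, then there are $c,\delta>0$ such that for all $n\ge1$ and every estimator $T=T(Y_1,\dots,Y_n)$ of the shift (which may use $f$ and $\phi$) there is $\theta^*\in\mathbb R$ with $$P_{n,\theta^*}\big(\sqrt n\,d(T,\theta^*)\ge c\big)\ge\delta .$$ -/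

import Mathlib

open MeasureTheory

noncomputable section

namespace TemplateMatching

/-- Two shifts are the same modulo the period `1`. -/
def SameShift (θ θ' : ℝ) : Prop := ∃ k : ℤ, θ = θ' + k

/-- Distance between two shifts modulo `1`: the distance from `θ - θ'` to the nearest integer. -/
def shiftDist (θ θ' : ℝ) : ℝ := |(θ - θ') - round (θ - θ')|

/-- A template: a Lipschitz function of period exactly `1`, in the sense that two different shifts
(modulo `1`) of it differ on a subset of positive measure of the unit interval. -/
structure IsTemplate (f : ℝ → ℝ) : Prop where
  periodic : Function.Periodic f 1
  exact_period : ∀ θ θ' : ℝ, ¬ SameShift θ θ' →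
    0 < volume {x ∈ Set.Icc (0 : ℝ) 1 | f (x - θ) ≠ f (x - θ')}
  lipschitz : ∃ L : NNReal, LipschitzWith L f

/-- A noise density: a bounded probability density on the line that is even. -/
structure IsNoiseDensity (φ : ℝ → ℝ) : Prop where
  measurable : Measurable φ
  nonneg : ∀ z, 0 ≤ φ z
  integral_eq_one : ∫ z, φ z = 1
  bounded : ∃ C : ℝ, ∀ z, φ z ≤ C
  even : ∀ z, φ (-z) = φ z

/-- The law of one noise variable. -/
def noiseLaw (φ : ℝ → ℝ) : Measure ℝ := volume.withDensity fun z => ENNReal.ofReal (φ z)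

/-- The distribution function of the noise. -/
def noiseCDF (φ : ℝ → ℝ) (t : ℝ) : ℝ := ∫ z in Set.Iic t, φ z

/-- `Φ₂ t = ∫ Φ (t + z) φ z dz`. -/
def noiseCDF₂ (φ : ℝ → ℝ) (t : ℝ) : ℝ := ∫ z, noiseCDF φ (t + z) * φ z

/-- The population criterion `M`, for the true shift `θs`, at the candidate shift `θ`. -/
def populationCriterion (f φ : ℝ → ℝ) (θs θ : ℝ) : ℝ :=
  ∫ x₀ in (0 : ℝ)..1, ∫ x in (0 : ℝ)..1, noiseCDF₂ φ (f x₀ - f x) * f (x₀ + θs - θ)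

/-- The true shift is (modulo `1`) the unique maximum point of the population criterion. -/
def TrueShiftIsUniqueMax (f φ : ℝ → ℝ) : Prop :=
  ∀ θs θ : ℝ, ¬ SameShift θ θs →
    populationCriterion f φ θs θ < populationCriterion f φ θs θs

/-- The design points `1/n, 2/n, …, n/n`. -/
def designPoint (n : ℕ) (i : Fin n) : ℝ := ((i : ℝ) + 1) / n

/-- The law of the sample `Y i = f (x i - θ) + Z i`, with `Z` iid of density `φ`. -/
def sampleLaw (f φ : ℝ → ℝ) (n : ℕ) (θ : ℝ) : Measure (Fin n → ℝ) :=
  (Measure.pi fun _ : Fin n => noiseLaw φ).map fun z i => f (designPoint n i - θ) + z i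

/-- The rank of `y i` among `y 1, …, y n`, in increasing order. -/
def rank {n : ℕ} (y : Fin n → ℝ) (i : Fin n) : ℕ :=
  (Finset.univ.filter fun j => y j ≤ y i).card

/-- The rank criterion `θ ↦ ∑ R i * f (x i - θ)`. -/
def rankCriterion (f : ℝ → ℝ) {n : ℕ} (y : Fin n → ℝ) (θ : ℝ) : ℝ :=
  ∑ i, (rank y i : ℝ) * f (designPoint n i - θ)

/-- An estimator of the shift: for each sample size, a function of the sample. -/
abbrev Estimator : Type := (n : ℕ) → (Fin n → ℝ) → ℝ

/-- An R-estimator: it picks, for every sample, some global maximizer of the rank criterion. -/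
def IsREstimator (f : ℝ → ℝ) (est : Estimator) : Prop :=
  ∀ (n : ℕ) (y : Fin n → ℝ) (θ : ℝ), rankCriterion f y θ ≤ rankCriterion f y (est n y)

/-- The estimator converges at rate `r`, uniformly in the true shift: the scaled error
`r n * shiftDist` is bounded in probability. -/
def AttainsRate (f φ : ℝ → ℝ) (r : ℕ → ℝ) (est : Estimator) : Prop :=
  ∀ ε : ℝ, 0 < ε → ∃ K : ℝ, ∀ n : ℕ, 1 ≤ n → ∀ θ : ℝ,
    sampleLaw f φ n θ {y | K < r n * shiftDist (est n y) θ} ≤ ENNReal.ofReal ε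

/-- No estimator beats the rate `r` in the minimax sense: at every sample size `n`, every estimator
(which may depend on `f` and `φ`) errs by at least `c / r n` with probability at least `δ`, at some
value of the true shift. -/
def IsMinimaxLowerRate (f φ : ℝ → ℝ) (r : ℕ → ℝ) : Prop :=
  ∃ c : ℝ, 0 < c ∧ ∃ δ : ℝ, 0 < δ ∧ ∀ n : ℕ, 1 ≤ n → ∀ T : (Fin n → ℝ) → ℝ, ∃ θ : ℝ,
    ENNReal.ofReal δ ≤ sampleLaw f φ n θ {y | c ≤ r n * shiftDist (T y) θ}

/-- The density has finite Fisher information for location: it is locally absolutely continuous and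
`∫ (φ')² / φ < ∞`. (The derivative vanishes almost everywhere on the zero set of `φ`, so the
convention `0 / 0 = 0` is the usual one.) -/
def HasFiniteFisherInformation (φ : ℝ → ℝ) : Prop :=
  (∀ a b : ℝ, AbsolutelyContinuousOnInterval φ a b) ∧
    Integrable (fun z => deriv φ z ^ 2 / φ z)

end TemplateMatching

end

noncomputable section

namespace TemplateMatching

open Set Filter Topology ProbabilityTheory

/-! Upper bound. Let t be the true shift. After division by n², the increment of the rank criterion
from t to θ splits into a mean and a centred fluctuation (`mean_rank_eq`). Up to an error C/n,
uniform in t and θ, the mean is at most `crossCorr (θ - t) - crossCorr 0` (`exists_mean_score_le`),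
and this falls at least quadratically in the distance modulo 1 (`exists_crossCorr_sq_le`). The
template is only Lipschitz, but averaging over the noise makes the limiting rank score G
continuously differentiable. Once the shift is moved onto G ∘ f, a second derivative of `crossCorr`
at 0 appears, equal to -∫ G'(f) f'². It is negative because f is not constant. Away from 0,
uniqueness of the maximum and compactness suffice.

The fluctuation is minus the integral of `slopeNoise` from t to θ. At each fixed u this slope has
second moment O(1/n), since comparisons of disjoint pairs of observations are uncorrelated. If a
maximizer lies at distance d ≥ a = K/√n, the fluctuation must be at least of order d², which forces
∫ |slope(u)| / ((u - t)² + a²) du above a fixed constant (`le_weightedNoise`). The mean of this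
integral is O(1/(a√n)) = O(1/K), and Markov's inequality concludes. One weighted integral serves all
scales d ≥ a simultaneously, so neither peeling nor a uniform bound on the slope is needed.

Lower bound. Finite Fisher information I makes the root density differentiable in mean square, so
the Hellinger affinity of two signals a, b is at least 1 - (a - b)² I/8
(`le_integral_sqrt_mul_sqrt`). Shifts at distance α/√n change each signal by O(1/√n), hence the
affinity of the two samples stays above 1/2 for small α, and Le Cam's two-point argument applies
(`exists_shift_of_affinity`). -/

/-- The density of the difference of two independent noise variables. -/
def noiseCorr (φ : ℝ → ℝ) (s : ℝ) : ℝ := ∫ z, φ (s + z) * φ z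

/-! ### Smoothness of the distribution function of a noise difference -/

section Noise

variable {φ : ℝ → ℝ} {C : ℝ}

theorem IsNoiseDensity.integrable (hφ : IsNoiseDensity φ) : Integrable φ := by
  by_contra h
  have := hφ.integral_eq_one
  rw [integral_undef h] at this
  norm_num at this

theorem IsNoiseDensity.bound_nonneg (hφ : IsNoiseDensity φ) (hC : ∀ z, φ z ≤ C) : 0 ≤ C :=
  (hφ.nonneg 0).trans (hC 0)

theorem IsNoiseDensity.abs_le (hφ : IsNoiseDensity φ) (hC : ∀ z, φ z ≤ C) (z : ℝ) : |φ z| ≤ C := by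
  rw [abs_of_nonneg (hφ.nonneg z)]; exact hC z

theorem IsNoiseDensity.integrable_mul (hφ : IsNoiseDensity φ) {h : ℝ → ℝ}
    (hm : Measurable h) {B : ℝ} (hb : ∀ z, |h z| ≤ B) : Integrable fun z => h z * φ z :=
  hφ.integrable.bdd_mul (c := B) hm.aestronglyMeasurable (Eventually.of_forall hb)

theorem noiseCDF_nonneg (hφ : IsNoiseDensity φ) (t : ℝ) : 0 ≤ noiseCDF φ t :=
  setIntegral_nonneg measurableSet_Iic fun z _ => hφ.nonneg z

theorem noiseCDF_le_one (hφ : IsNoiseDensity φ) (t : ℝ) : noiseCDF φ t ≤ 1 := by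
  rw [← hφ.integral_eq_one]
  exact setIntegral_le_integral hφ.integrable (Eventually.of_forall hφ.nonneg)

theorem noiseCDF_sub (hφ : IsNoiseDensity φ) (a b : ℝ) :
    noiseCDF φ b - noiseCDF φ a = ∫ z in a..b, φ z :=
  intervalIntegral.integral_Iic_sub_Iic hφ.integrable.integrableOn hφ.integrable.integrableOn

theorem noiseCDF_lipschitz (hφ : IsNoiseDensity φ) (hC : ∀ z, φ z ≤ C) :
    LipschitzWith C.toNNReal (noiseCDF φ) := by
  refine LipschitzWith.of_dist_le_mul fun a b => ?_
  rw [dist_comm a b, dist_comm, Real.dist_eq, Real.dist_eq, noiseCDF_sub hφ,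
    Real.coe_toNNReal _ (hφ.bound_nonneg hC)]
  exact intervalIntegral.norm_integral_le_of_norm_le_const fun z _ =>
    (Real.norm_eq_abs _).trans_le (hφ.abs_le hC z)

theorem noiseCDF_ae_hasDerivAt (hφ : IsNoiseDensity φ) :
    ∀ᵐ x, HasDerivAt (noiseCDF φ) (φ x) x := by
  filter_upwards [LocallyIntegrable.ae_hasDerivAt_integral hφ.integrable.locallyIntegrable]
    with x hx
  have : noiseCDF φ = fun x => (∫ t in (0 : ℝ)..x, φ t) + noiseCDF φ 0 := by
    funext y
    rw [← noiseCDF_sub hφ]; ring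
  rw [this]
  exact (hx 0).add_const _

theorem noiseCDF₂_nonneg (hφ : IsNoiseDensity φ) (t : ℝ) : 0 ≤ noiseCDF₂ φ t :=
  integral_nonneg fun z => mul_nonneg (noiseCDF_nonneg hφ _) (hφ.nonneg z)

theorem noiseCDF₂_integrable (hφ : IsNoiseDensity φ) (t : ℝ) :
    Integrable fun z => noiseCDF φ (t + z) * φ z := by
  obtain ⟨C, hC⟩ := hφ.bounded
  refine hφ.integrable_mul (B := 1) ?_ fun z => ?_
  · exact (noiseCDF_lipschitz hφ hC).continuous.measurable.comp (measurable_const_add t)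
  · rw [abs_of_nonneg (noiseCDF_nonneg hφ _)]; exact noiseCDF_le_one hφ _

theorem noiseCDF₂_le_one (hφ : IsNoiseDensity φ) (t : ℝ) : noiseCDF₂ φ t ≤ 1 := by
  rw [← hφ.integral_eq_one]
  refine integral_mono (noiseCDF₂_integrable hφ t) hφ.integrable fun z => ?_
  exact mul_le_of_le_one_left (hφ.nonneg z) (noiseCDF_le_one hφ _)

theorem noiseCorr_integrable (hφ : IsNoiseDensity φ) (t : ℝ) :
    Integrable fun z => φ (t + z) * φ z := by
  obtain ⟨C, hC⟩ := hφ.bounded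
  exact hφ.integrable_mul (hφ.measurable.comp (measurable_const_add t)) fun z => hφ.abs_le hC _

/-- The density need not be continuous. It is enough that `noiseCDF` is Lipschitz (φ is bounded) and
has derivative φ almost everywhere (Lebesgue): a null set of bad points is invisible to the outer
integral. -/
theorem hasDerivAt_noiseCDF₂ (hφ : IsNoiseDensity φ) (t : ℝ) :
    HasDerivAt (noiseCDF₂ φ) (noiseCorr φ t) t := by
  obtain ⟨C, hC⟩ := hφ.bounded
  have hLip := noiseCDF_lipschitz hφ hC
  refine (hasDerivAt_integral_of_dominated_loc_of_lip (s := univ) (bound := fun z => C * φ z)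
    univ_mem (Eventually.of_forall fun x => (noiseCDF₂_integrable hφ x).aestronglyMeasurable)
    (noiseCDF₂_integrable hφ t) (noiseCorr_integrable hφ t).aestronglyMeasurable
    (Eventually.of_forall fun z => ?_) (hφ.integrable.const_mul C) ?_).2
  · refine LipschitzOnWith.of_dist_le_mul fun a _ b _ => ?_
    have h1 := hLip.dist_le_mul (a + z) (b + z)
    rw [Real.coe_toNNReal _ (hφ.bound_nonneg hC), dist_add_right] at h1
    rw [Real.coe_nnabs, abs_of_nonneg (mul_nonneg (hφ.bound_nonneg hC) (hφ.nonneg z)),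
      Real.dist_eq, ← sub_mul, abs_mul, abs_of_nonneg (hφ.nonneg z), ← Real.dist_eq]
    nlinarith [hφ.nonneg z]
  · have := (measurePreserving_add_left volume t).quasiMeasurePreserving.ae
      (noiseCDF_ae_hasDerivAt hφ)
    filter_upwards [this] with z hz
    exact (hz.comp_add_const t z).mul_const (φ z)

theorem noiseCorr_nonneg (hφ : IsNoiseDensity φ) (t : ℝ) : 0 ≤ noiseCorr φ t :=
  integral_nonneg fun z => mul_nonneg (hφ.nonneg _) (hφ.nonneg z)

theorem noiseCorr_le (hφ : IsNoiseDensity φ) (hC : ∀ z, φ z ≤ C) (t : ℝ) : noiseCorr φ t ≤ C := by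
  have : ∫ z, C * φ z = C := by rw [integral_const_mul, hφ.integral_eq_one, mul_one]
  rw [← this]
  exact integral_mono (noiseCorr_integrable hφ t) (hφ.integrable.const_mul C)
    fun z => mul_le_mul_of_nonneg_right (hC _) (hφ.nonneg z)

/-- Replace the translated factor by a continuous, compactly supported L¹-approximation. As the
other factor is bounded, the error is uniform in s, and uniform limits of continuous functions are
continuous. -/
theorem continuous_noiseCorr (hφ : IsNoiseDensity φ) : Continuous (noiseCorr φ) := by
  obtain ⟨C, hC⟩ := hφ.bounded
  refine continuous_of_uniform_approx_of_continuous fun u hu => ?_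
  obtain ⟨ε, hε, hεu⟩ := Metric.mem_uniformity_dist.1 hu
  have hC0 := hφ.bound_nonneg hC
  obtain ⟨h, hcs, hh, hcont, hint⟩ := hφ.integrable.exists_hasCompactSupport_integral_sub_le
    (ε := ε / (2 * (C + 1))) (by positivity)
  obtain ⟨B, hB⟩ := hcs.exists_bound_of_continuous hcont
  have hI : ∀ s, Integrable fun z => h (s + z) * φ z := fun s =>
    hφ.integrable_mul (hcont.measurable.comp (measurable_const_add s)) fun z => hB _
  refine ⟨fun s => ∫ z, h (s + z) * φ z, ?_, fun s => hεu ?_⟩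
  · refine continuous_of_dominated (bound := fun z => B * φ z)
      (fun s => (hI s).aestronglyMeasurable)
      (fun s => Eventually.of_forall fun z => ?_) (hφ.integrable.const_mul B)
      (Eventually.of_forall fun z => by fun_prop)
    rw [norm_mul, Real.norm_of_nonneg (hφ.nonneg z)]
    exact mul_le_mul_of_nonneg_right (hB _) (hφ.nonneg z)
  · have hd : Integrable fun z => ‖φ z - h z‖ := (hφ.integrable.sub hint).norm
    calc dist (noiseCorr φ s) (∫ z, h (s + z) * φ z)
        = ‖∫ z, (φ (s + z) * φ z - h (s + z) * φ z)‖ := by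
          rw [integral_sub (noiseCorr_integrable hφ s) (hI s)]; rfl
      _ ≤ ∫ z, C * ‖φ (s + z) - h (s + z)‖ := by
          refine norm_integral_le_of_norm_le ((hd.comp_add_left s).const_mul C)
            (Eventually.of_forall fun z => ?_)
          rw [← sub_mul, norm_mul, mul_comm]
          exact mul_le_mul_of_nonneg_right (hφ.abs_le hC z) (norm_nonneg _)
      _ = C * ∫ z, ‖φ z - h z‖ := by
          rw [integral_const_mul, integral_add_left_eq_self (fun z => ‖φ z - h z‖) s]
      _ ≤ C * (ε / (2 * (C + 1))) := mul_le_mul_of_nonneg_left hh hC0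
      _ < ε := by
          rw [← mul_div_assoc, div_lt_iff₀ (by positivity)]
          nlinarith

theorem noiseCorr_zero_pos (hφ : IsNoiseDensity φ) : 0 < noiseCorr φ 0 := by
  refine (noiseCorr_nonneg hφ 0).lt_of_ne fun h => ?_
  have h0 := (integral_eq_zero_iff_of_nonneg
    (fun z => mul_nonneg (hφ.nonneg _) (hφ.nonneg z)) (noiseCorr_integrable hφ 0)).1 h.symm
  have : φ =ᵐ[volume] 0 := by
    filter_upwards [h0] with z hz
    simpa using hz
  have h1 := hφ.integral_eq_one
  rw [integral_congr_ae this] at h1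
  simp at h1

theorem noiseCDF₂_lipschitz (hφ : IsNoiseDensity φ) (hC : ∀ z, φ z ≤ C) :
    LipschitzWith C.toNNReal (noiseCDF₂ φ) := by
  refine lipschitzWith_of_nnnorm_deriv_le (fun t => (hasDerivAt_noiseCDF₂ hφ t).differentiableAt)
    fun t => ?_
  rw [(hasDerivAt_noiseCDF₂ hφ t).deriv, ← NNReal.coe_le_coe, coe_nnnorm,
    Real.norm_of_nonneg (noiseCorr_nonneg hφ t), Real.coe_toNNReal _ (hφ.bound_nonneg hC)]
  exact noiseCorr_le hφ hC t

end Noise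

/-! ### The population criterion and its quadratic decay -/

/-- The limiting normalized rank of an observation with signal `s`. -/
def rankScore (f φ : ℝ → ℝ) (s : ℝ) : ℝ := ∫ x in (0 : ℝ)..1, noiseCDF₂ φ (s - f x)

/-- The derivative of `rankScore`. -/
def rankScoreDeriv (f φ : ℝ → ℝ) (s : ℝ) : ℝ := ∫ x in (0 : ℝ)..1, noiseCorr φ (s - f x)

/-- The population criterion as a function of the difference of the shifts. -/
def crossCorr (f φ : ℝ → ℝ) (s : ℝ) : ℝ := ∫ x in (0 : ℝ)..1, rankScore f φ (f x) * f (x - s)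

/-- The negative of the derivative of `crossCorr`. -/
def crossCorrSlope (f φ : ℝ → ℝ) (s : ℝ) : ℝ :=
  ∫ x in (0 : ℝ)..1, rankScore f φ (f x) * deriv f (x - s)

theorem populationCriterion_eq (f φ : ℝ → ℝ) (θs θ : ℝ) :
    populationCriterion f φ θs θ = crossCorr f φ (θ - θs) := by
  unfold populationCriterion crossCorr rankScore
  refine intervalIntegral.integral_congr fun x _ => ?_
  simp only [intervalIntegral.integral_mul_const]
  congr 2
  ring

theorem integral_zero_one_comp_add {E : Type*} [NormedAddCommGroup E] [NormedSpace ℝ E]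
    {h : ℝ → E} (hh : Function.Periodic h 1) (s : ℝ) :
    ∫ x in (0 : ℝ)..1, h (x + s) = ∫ x in (0 : ℝ)..1, h x := by
  rw [intervalIntegral.integral_comp_add_right h s, zero_add, add_comm 1 s,
    hh.intervalIntegral_add_eq s 0, zero_add]

theorem periodic_deriv {h : ℝ → ℝ} (hh : Function.Periodic h 1) :
    Function.Periodic (deriv h) 1 := fun x => by
  rw [← deriv_comp_add_const]
  exact congrArg (fun k => deriv k x) (funext hh)

section

variable {f φ : ℝ → ℝ} {C : ℝ} {L : NNReal}

theorem IsTemplate.exists_bound (hf : IsTemplate f) : ∃ B, ∀ x, |f x| ≤ B := by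
  obtain ⟨L, hL⟩ := hf.lipschitz
  obtain ⟨B, hB⟩ := isCompact_Icc.exists_bound_of_continuousOn (s := Icc (0 : ℝ) (0 + 1))
    hL.continuous.continuousOn
  refine ⟨B, fun x => ?_⟩
  obtain ⟨y, hy, hxy⟩ := hf.periodic.exists_mem_Ico zero_lt_one x 0
  rw [hxy]
  exact hB y (Ico_subset_Icc_self hy)

theorem IsTemplate.continuous (hf : IsTemplate f) : Continuous f :=
  hf.lipschitz.elim fun _ h => h.continuous

theorem rankScore_integrable (hf : IsTemplate f) (hφ : IsNoiseDensity φ) (s a b : ℝ) :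
    IntervalIntegrable (fun x => noiseCDF₂ φ (s - f x)) volume a b := by
  obtain ⟨C, hC⟩ := hφ.bounded
  exact ((noiseCDF₂_lipschitz hφ hC).continuous.comp
    (continuous_const.sub hf.continuous)).intervalIntegrable _ _

theorem rankScore_nonneg (hφ : IsNoiseDensity φ) (s : ℝ) : 0 ≤ rankScore f φ s :=
  intervalIntegral.integral_nonneg zero_le_one fun _ _ => noiseCDF₂_nonneg hφ _

theorem rankScore_le_one (hf : IsTemplate f) (hφ : IsNoiseDensity φ) (s : ℝ) :
    rankScore f φ s ≤ 1 := by
  have := intervalIntegral.integral_mono_on zero_le_one (rankScore_integrable hf hφ s 0 1)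
    (intervalIntegrable_const (c := (1 : ℝ))) fun x _ => noiseCDF₂_le_one hφ (s - f x)
  simpa [rankScore] using this

theorem hasDerivAt_rankScore (hf : IsTemplate f) (hφ : IsNoiseDensity φ) (s : ℝ) :
    HasDerivAt (rankScore f φ) (rankScoreDeriv f φ s) s := by
  obtain ⟨C, hC⟩ := hφ.bounded
  have hc : ∀ s, Continuous fun x => noiseCDF₂ φ (s - f x) := fun s =>
    (noiseCDF₂_lipschitz hφ hC).continuous.comp (continuous_const.sub hf.continuous)
  refine (intervalIntegral.hasDerivAt_integral_of_dominated_loc_of_deriv_le (s := univ)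
    (F' := fun r x => noiseCorr φ (r - f x))
    (bound := fun _ => C) univ_mem (Eventually.of_forall fun x => (hc x).aestronglyMeasurable)
    (rankScore_integrable hf hφ s 0 1) ?_ (Eventually.of_forall fun x _ r _ => ?_)
    intervalIntegrable_const (Eventually.of_forall fun x _ r _ => ?_)).2
  · exact ((continuous_noiseCorr hφ).comp
      (continuous_const.sub hf.continuous)).aestronglyMeasurable
  · rw [Real.norm_of_nonneg (noiseCorr_nonneg hφ _)]
    exact noiseCorr_le hφ hC _
  · exact (hasDerivAt_noiseCDF₂ hφ (r - f x)).comp_sub_const r (f x)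

theorem rankScore_lipschitz (hf : IsTemplate f) (hφ : IsNoiseDensity φ) (hC : ∀ z, φ z ≤ C) :
    LipschitzWith C.toNNReal (rankScore f φ) := by
  refine LipschitzWith.of_dist_le_mul fun a b => ?_
  rw [Real.dist_eq, rankScore, rankScore, ← intervalIntegral.integral_sub
    (rankScore_integrable hf hφ a 0 1) (rankScore_integrable hf hφ b 0 1)]
  have h : ∀ x ∈ uIoc (0 : ℝ) 1,
      ‖noiseCDF₂ φ (a - f x) - noiseCDF₂ φ (b - f x)‖ ≤ C.toNNReal * dist a b := fun x _ => by
    have := (noiseCDF₂_lipschitz hφ hC).dist_le_mul (a - f x) (b - f x)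
    rwa [dist_sub_right, Real.dist_eq] at this
  have := intervalIntegral.norm_integral_le_of_norm_le_const h
  rwa [sub_zero, abs_one, mul_one] at this

theorem continuous_rankScoreDeriv (hf : IsTemplate f) (hφ : IsNoiseDensity φ) :
    Continuous (rankScoreDeriv f φ) := by
  refine intervalIntegral.continuous_parametric_intervalIntegral_of_continuous' ?_ 0 1
  have := hf.continuous
  exact (continuous_noiseCorr hφ).comp (by fun_prop)

/-- The integrand is continuous and nonnegative, and at the point x itself it equals ∫ φ² > 0. By
periodicity the integral may be taken over [x, x + 1], which contains x. -/
theorem rankScoreDeriv_pos (hf : IsTemplate f) (hφ : IsNoiseDensity φ) (x : ℝ) :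
    0 < rankScoreDeriv f φ (f x) := by
  have hper : Function.Periodic (fun y => noiseCorr φ (f x - f y)) 1 := fun y => by
    simp only [hf.periodic y]
  have h := hper.intervalIntegral_add_eq 0 x
  rw [zero_add] at h
  rw [rankScoreDeriv, h]
  refine intervalIntegral.integral_pos (by linarith)
    ((continuous_noiseCorr hφ).comp (continuous_const.sub hf.continuous)).continuousOn
    (fun _ _ => noiseCorr_nonneg hφ _) ⟨x, ⟨le_rfl, by linarith⟩, ?_⟩
  rw [sub_self]
  exact noiseCorr_zero_pos hφ

theorem continuous_rankScore_comp (hf : IsTemplate f) (hφ : IsNoiseDensity φ) :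
    Continuous fun x => rankScore f φ (f x) := by
  obtain ⟨C, hC⟩ := hφ.bounded
  exact (rankScore_lipschitz hf hφ hC).continuous.comp hf.continuous

theorem abs_deriv_le (hL : LipschitzWith L f) (x : ℝ) : |deriv f x| ≤ L :=
  norm_deriv_le_of_lipschitz hL

theorem intervalIntegrable_deriv_of_lipschitz (hL : LipschitzWith L f) (a b : ℝ) :
    IntervalIntegrable (deriv f) volume a b :=
  (intervalIntegrable_const (c := (L : ℝ))).mono_fun (measurable_deriv f).aestronglyMeasurable
    (Eventually.of_forall fun x => (abs_deriv_le hL x).trans (le_abs_self _))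

theorem integral_deriv_of_lipschitz (hL : LipschitzWith L f) (a b : ℝ) :
    ∫ x in a..b, deriv f x = f b - f a :=
  (hL.lipschitzOnWith (s := uIcc a b)).absolutelyContinuousOnInterval.integral_deriv_eq_sub

theorem hasDerivAt_crossCorr (hf : IsTemplate f) (hφ : IsNoiseDensity φ) (s : ℝ) :
    HasDerivAt (crossCorr f φ) (-crossCorrSlope f φ s) s := by
  obtain ⟨L, hL⟩ := hf.lipschitz
  have hG := continuous_rankScore_comp hf hφ
  have hfc := hf.continuous
  have hc : ∀ s, Continuous fun x => rankScore f φ (f x) * f (x - s) := fun s => by fun_prop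
  rw [crossCorrSlope, ← intervalIntegral.integral_neg]
  refine (intervalIntegral.hasDerivAt_integral_of_dominated_loc_of_lip (s := univ)
    (bound := fun _ => (L : ℝ)) univ_mem
    (Eventually.of_forall fun s => (hc s).aestronglyMeasurable)
    ((hc s).intervalIntegrable _ _) ?_ (Eventually.of_forall fun x _ => ?_)
    intervalIntegrable_const ?_).2
  · exact ((hG.measurable.mul
      ((measurable_deriv f).comp (measurable_id.sub_const s))).neg).aestronglyMeasurable
  · refine LipschitzOnWith.of_dist_le_mul fun a _ b _ => ?_
    have h1 := hL.dist_le_mul (x - a) (x - b)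
    rw [dist_sub_left] at h1
    rw [Real.coe_nnabs, abs_of_nonneg L.coe_nonneg, Real.dist_eq, ← mul_sub, abs_mul,
      abs_of_nonneg (rankScore_nonneg hφ _), ← Real.dist_eq]
    exact (mul_le_of_le_one_left dist_nonneg (rankScore_le_one hf hφ _)).trans h1
  · have := (measurePreserving_sub_right volume s).quasiMeasurePreserving.ae
      (hL.ae_differentiableAt_of_real (μ := volume))
    filter_upwards [this] with x hx _
    have := (hx.hasDerivAt.comp_const_sub x s).const_mul (rankScore f φ (f x))
    rwa [mul_neg] at this

/-- The factor f' is merely bounded and measurable, so it cannot be differentiated again.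
Translating by s over a period moves the parameter to the Lipschitz factor G ∘ f, which makes a
second differentiation possible. -/
theorem crossCorrSlope_eq (hf : IsTemplate f) (s : ℝ) :
    crossCorrSlope f φ s = ∫ x in (0 : ℝ)..1, rankScore f φ (f (x + s)) * deriv f x := by
  have hper : Function.Periodic (fun x => rankScore f φ (f x) * deriv f (x - s)) 1 := fun x => by
    simp only [hf.periodic x]
    rw [add_sub_right_comm, periodic_deriv hf.periodic]
  rw [crossCorrSlope, ← integral_zero_one_comp_add hper s]
  simp only [add_sub_cancel_right]

theorem hasDerivAt_crossCorrSlope_zero (hf : IsTemplate f) (hφ : IsNoiseDensity φ) :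
    HasDerivAt (crossCorrSlope f φ)
      (∫ x in (0 : ℝ)..1, rankScoreDeriv f φ (f x) * deriv f x ^ 2) 0 := by
  obtain ⟨L, hL⟩ := hf.lipschitz
  obtain ⟨C, hC⟩ := hφ.bounded
  have hG := continuous_rankScore_comp hf hφ
  have hGL := (rankScore_lipschitz hf hφ hC).comp hL
  have hm : ∀ s, Measurable fun x => rankScore f φ (f (x + s)) * deriv f x := fun s =>
    (hG.measurable.comp (measurable_id.add_const s)).mul (measurable_deriv f)
  rw [funext (crossCorrSlope_eq (φ := φ) hf)]
  refine (intervalIntegral.hasDerivAt_integral_of_dominated_loc_of_lip (s := univ)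
    (bound := fun _ => ((C.toNNReal * L * L : NNReal) : ℝ)) univ_mem
    (Eventually.of_forall fun s => (hm s).aestronglyMeasurable)
    ?_ ?_ (Eventually.of_forall fun x _ => ?_) intervalIntegrable_const ?_).2
  · refine (intervalIntegrable_const (c := (L : ℝ))).mono_fun (hm 0).aestronglyMeasurable
      (Eventually.of_forall fun x => ?_)
    beta_reduce
    rw [norm_mul, Real.norm_of_nonneg (rankScore_nonneg hφ _), Real.norm_of_nonneg L.coe_nonneg]
    exact (mul_le_of_le_one_left (norm_nonneg _) (rankScore_le_one hf hφ _)).trans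
      (abs_deriv_le hL x)
  · exact (((continuous_rankScoreDeriv hf hφ).comp hf.continuous).measurable.mul
      ((measurable_deriv f).pow_const 2)).aestronglyMeasurable
  · refine LipschitzOnWith.of_dist_le_mul fun a _ b _ => ?_
    have h1 := hGL.dist_le_mul (x + a) (x + b)
    rw [dist_add_left] at h1
    rw [Real.coe_nnabs, abs_of_nonneg (NNReal.coe_nonneg _), Real.dist_eq, ← sub_mul, abs_mul,
      ← Real.dist_eq, NNReal.coe_mul, mul_right_comm]
    exact mul_le_mul h1 (abs_deriv_le hL x) (abs_nonneg _) (by positivity)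
  · filter_upwards [hL.ae_differentiableAt_of_real (μ := volume)] with x hx _
    have h1 : HasDerivAt (fun s => f (x + s)) (deriv f x) 0 :=
      HasDerivAt.comp_const_add x 0 (by rw [add_zero]; exact hx.hasDerivAt)
    have h2 : HasDerivAt (rankScore f φ) (rankScoreDeriv f φ (f x)) (f (x + 0)) := by
      rw [add_zero]; exact hasDerivAt_rankScore hf hφ (f x)
    have := (h2.comp (0 : ℝ) h1).mul_const (deriv f x)
    rwa [mul_assoc, ← sq] at this

/-- Since the score derivative is positive along f, a zero integral would give f' = 0 almost
everywhere. A Lipschitz function is the integral of its derivative, so f would be constant, against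
`exact_period` for the shifts 0 and 1/2. -/
theorem crossCorr_curvature_pos (hf : IsTemplate f) (hφ : IsNoiseDensity φ) :
    0 < ∫ x in (0 : ℝ)..1, rankScoreDeriv f φ (f x) * deriv f x ^ 2 := by
  obtain ⟨L, hL⟩ := hf.lipschitz
  have hnn : ∀ x, 0 ≤ rankScoreDeriv f φ (f x) * deriv f x ^ 2 := fun x =>
    mul_nonneg (rankScoreDeriv_pos hf hφ x).le (sq_nonneg _)
  refine (intervalIntegral.integral_nonneg zero_le_one fun x _ => hnn x).lt_of_ne fun h => ?_
  obtain ⟨B, hB⟩ := isCompact_Icc.exists_bound_of_continuousOn (s := Icc (0 : ℝ) 1)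
    ((continuous_rankScoreDeriv hf hφ).comp hf.continuous).continuousOn
  have hint : IntervalIntegrable (fun x => rankScoreDeriv f φ (f x) * deriv f x ^ 2)
      volume 0 1 := by
    rw [intervalIntegrable_iff_integrableOn_Ioc_of_le zero_le_one]
    refine Measure.integrableOn_of_bounded (M := B * L ^ 2) (by simp)
      (((continuous_rankScoreDeriv hf hφ).comp hf.continuous).measurable.mul
        ((measurable_deriv f).pow_const 2)).aestronglyMeasurable ?_
    refine (ae_restrict_iff' measurableSet_Ioc).2 (Eventually.of_forall fun x hx => ?_)
    rw [norm_mul, norm_pow]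
    have h0 := hB x (Ioc_subset_Icc_self hx)
    exact mul_le_mul h0 (pow_le_pow_left₀ (norm_nonneg _) (abs_deriv_le hL x) 2)
      (by positivity) ((norm_nonneg _).trans h0)
  have h0 := (intervalIntegral.integral_eq_zero_iff_of_le_of_nonneg_ae zero_le_one
    (Eventually.of_forall hnn) hint).1 h.symm
  have hd : ∀ᵐ x, x ∈ Ioc (0 : ℝ) 1 → deriv f x = 0 := by
    rw [← ae_restrict_iff' measurableSet_Ioc]
    filter_upwards [h0] with x hx
    simpa [(rankScoreDeriv_pos hf hφ x).ne'] using hx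
  have hconst : ∀ y ∈ Icc (0 : ℝ) 1, f y = f 0 := fun y hy => by
    have := integral_deriv_of_lipschitz hL 0 y
    rw [intervalIntegral.integral_zero_ae] at this
    · linarith
    · filter_upwards [hd] with x hx hxy
      rw [uIoc_of_le hy.1] at hxy
      exact hx ⟨hxy.1, hxy.2.trans hy.2⟩
  have hall : ∀ y, f y = f 0 := fun y => by
    obtain ⟨z, hz, hyz⟩ := hf.periodic.exists_mem_Ico zero_lt_one y 0
    rw [hyz]
    exact hconst z (by simpa using Ico_subset_Icc_self hz)
  have hne : ¬ SameShift 0 (1 / 2) := by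
    rintro ⟨k, hk⟩
    have h2 : (2 * k + 1 : ℝ) = 0 := by linarith
    have h3 : (2 * k + 1 : ℤ) = 0 := by exact_mod_cast h2
    omega
  have := hf.exact_period 0 (1 / 2) hne
  simp only [hall (_ - _), ne_eq, not_true_eq_false, and_false, ofPred_false,
    measure_empty, lt_irrefl] at this

end

/-- A second derivative at the single point 0 suffices: it gives D s ≥ (A/2) s for small s ≥ 0, so h
s - (A/4) s² is nondecreasing there. -/
theorem exists_sq_le_of_hasDerivAt {h D : ℝ → ℝ} {A : ℝ} (hA : 0 < A)
    (hh : ∀ s, HasDerivAt h (D s) s) (h0 : h 0 = 0) (hD0 : D 0 = 0) (hD : HasDerivAt D A 0) :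
    ∃ η > 0, ∀ s ∈ Icc 0 η, A / 4 * s ^ 2 ≤ h s := by
  have hev : ∀ᶠ s in 𝓝 (0 : ℝ), |D s - A * s| ≤ A / 2 * |s| := by
    have := hD.isLittleO.def (half_pos hA)
    filter_upwards [this] with s hs
    simpa [hD0, mul_comm] using hs
  obtain ⟨η, hη, hball⟩ := Metric.eventually_nhds_iff.1 hev
  refine ⟨η / 2, half_pos hη, fun s hs => ?_⟩
  have hder : ∀ s, HasDerivAt (fun s => h s - A / 4 * s ^ 2) (D s - A / 2 * s) s := fun s => by
    have h1 := (hh s).sub ((hasDerivAt_pow 2 s).const_mul (A / 4))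
    have h2 : D s - A / 4 * (((2 : ℕ) : ℝ) * s ^ (2 - 1)) = D s - A / 2 * s := by push_cast; ring
    rw [h2] at h1
    exact h1
  have hmono : MonotoneOn (fun s => h s - A / 4 * s ^ 2) (Icc 0 (η / 2)) := by
    refine monotoneOn_of_deriv_nonneg (convex_Icc _ _)
      (fun s _ => (hder s).continuousAt.continuousWithinAt)
      (fun s _ => (hder s).differentiableAt.differentiableWithinAt) fun s hs => ?_
    rw [interior_Icc] at hs
    rw [(hder s).deriv]
    have h1 := hball (y := s) (by rw [Real.dist_eq, sub_zero, abs_of_pos hs.1]; linarith [hs.2])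
    rw [abs_of_pos hs.1] at h1
    linarith [(abs_le.1 h1).1]
  have := hmono ⟨le_rfl, (half_pos hη).le⟩ hs hs.1
  simp only [h0] at this
  linarith

theorem exists_crossCorr_sq_le {f φ : ℝ → ℝ} (hf : IsTemplate f) (hφ : IsNoiseDensity φ)
    (hM : TrueShiftIsUniqueMax f φ) :
    ∃ c > 0, ∀ s, |s| ≤ 1 / 2 → c * s ^ 2 ≤ crossCorr f φ 0 - crossCorr f φ s := by
  have hcont : Continuous (crossCorr f φ) :=
    continuous_iff_continuousAt.2 fun s => (hasDerivAt_crossCorr hf hφ s).continuousAt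
  have hlt : ∀ s, |s| ≤ 1 / 2 → s ≠ 0 → crossCorr f φ s < crossCorr f φ 0 := fun s hs hs0 => by
    have := hM 0 s fun ⟨k, hk⟩ => by
      have h1 : |(k : ℝ)| < 1 := by rw [zero_add] at hk; rw [← hk]; linarith
      have h2 : |k| < 1 := by exact_mod_cast h1
      rw [Int.abs_lt_one_iff] at h2
      apply hs0
      rw [hk, h2]; simp
    simpa [populationCriterion_eq] using this
  have hmax : IsLocalMax (crossCorr f φ) 0 := by
    filter_upwards [Metric.ball_mem_nhds (0 : ℝ) one_half_pos] with s hs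
    rw [Metric.mem_ball, Real.dist_eq, sub_zero] at hs
    rcases eq_or_ne s 0 with rfl | h
    · rfl
    · exact (hlt s hs.le h).le
  have hD0 : crossCorrSlope f φ 0 = 0 :=
    neg_eq_zero.1 (hmax.hasDerivAt_eq_zero (hasDerivAt_crossCorr hf hφ 0))
  have hA := crossCorr_curvature_pos hf hφ
  have hD := hasDerivAt_crossCorrSlope_zero hf hφ
  set A := ∫ x in (0 : ℝ)..1, rankScoreDeriv f φ (f x) * deriv f x ^ 2
  obtain ⟨η₁, hη₁, h₁⟩ := exists_sq_le_of_hasDerivAt hA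
    (h := fun s => crossCorr f φ 0 - crossCorr f φ s)
    (fun s => by simpa using (hasDerivAt_crossCorr hf hφ s).const_sub (crossCorr f φ 0))
    (sub_self _) hD0 hD
  -- The one-sided bound for the reflected function covers negative s.
  obtain ⟨η₂, hη₂, h₂⟩ := exists_sq_le_of_hasDerivAt hA
    (h := fun s => crossCorr f φ 0 - crossCorr f φ (-s)) (D := fun s => -crossCorrSlope f φ (-s))
    (fun s => by
      have h1 : HasDerivAt (crossCorr f φ) (-crossCorrSlope f φ (-s)) (-s) :=
        hasDerivAt_crossCorr hf hφ (-s)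
      have := (HasDerivAt.scomp s h1 (hasDerivAt_neg s)).const_sub (crossCorr f φ 0)
      simpa [Function.comp_def] using this)
    (by simp) (by simp [hD0])
    (by
      have h1 : HasDerivAt (crossCorrSlope f φ) A (-0) := by rwa [neg_zero]
      have h2 := (HasDerivAt.scomp (0 : ℝ) h1 (hasDerivAt_neg 0)).neg
      rw [neg_smul, neg_neg, one_smul] at h2
      exact h2)
  set η := min η₁ η₂
  have hη : 0 < η := lt_min hη₁ hη₂
  have hnear : ∀ s, |s| ≤ η → A / 4 * s ^ 2 ≤ crossCorr f φ 0 - crossCorr f φ s := fun s hs => by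
    rcases le_total 0 s with h | h
    · rw [abs_of_nonneg h] at hs
      exact h₁ s ⟨h, hs.trans (min_le_left _ _)⟩
    · rw [abs_of_nonpos h] at hs
      have := h₂ (-s) ⟨by linarith, hs.trans (min_le_right _ _)⟩
      simpa using this
  have hK : IsCompact (Icc (-(1 / 2) : ℝ) (1 / 2) ∩ {s | η ≤ |s|}) :=
    isCompact_Icc.inter_right (isClosed_le continuous_const continuous_abs)
  have hfar : ∃ κ > 0, ∀ s ∈ Icc (-(1 / 2) : ℝ) (1 / 2) ∩ {s | η ≤ |s|},
      κ ≤ crossCorr f φ 0 - crossCorr f φ s := by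
    rcases (Icc (-(1 / 2) : ℝ) (1 / 2) ∩ {s | η ≤ |s|}).eq_empty_or_nonempty with he | hne
    · exact ⟨1, one_pos, fun s hs => absurd hs (by rw [he]; exact notMem_empty s)⟩
    · obtain ⟨s₀, hs₀, hmin⟩ := hK.exists_isMinOn hne
        (continuous_const.sub hcont : Continuous fun s =>
          crossCorr f φ 0 - crossCorr f φ s).continuousOn
      refine ⟨_, sub_pos.2 (hlt s₀ (abs_le.2 hs₀.1) ?_), fun s hs => hmin hs⟩
      rintro rfl
      have := hs₀.2
      simp only [mem_ofPred_eq, abs_zero] at this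
      linarith
  obtain ⟨κ, hκ, hfar⟩ := hfar
  -- Far from 0 the drop is at least κ, and κ ≥ 4κ s² because |s| ≤ 1/2.
  refine ⟨min (A / 4) (4 * κ), lt_min (by positivity) (by positivity), fun s hs => ?_⟩
  rcases le_total (|s|) η with h | h
  · exact (mul_le_mul_of_nonneg_right (min_le_left _ _) (sq_nonneg s)).trans (hnear s h)
  · have h3 := hfar s ⟨abs_le.1 hs, h⟩
    have h4 : s ^ 2 ≤ 1 / 4 := by
      rw [← sq_abs]; nlinarith [abs_nonneg s]
    have h5 := mul_le_mul_of_nonneg_right (min_le_right (A / 4) (4 * κ)) (sq_nonneg s)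
    nlinarith

/-! ### Riemann sums over the design and the mean of the rank criterion -/

theorem abs_mean_designPoint_sub_integral_le {h : ℝ → ℝ} {K : NNReal} (hh : LipschitzWith K h)
    {n : ℕ} (hn : 1 ≤ n) :
    |(n : ℝ)⁻¹ * ∑ i, h (designPoint n i) - ∫ x in (0 : ℝ)..1, h x| ≤ K / n := by
  have hn0 : (0 : ℝ) < n := by exact_mod_cast hn
  have hsum := intervalIntegral.sum_integral_adjacent_intervals (f := h) (μ := volume)
    (a := fun k : ℕ => (k : ℝ) / n) (n := n) fun k _ => hh.continuous.intervalIntegrable _ _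
  simp only [Nat.cast_zero, zero_div, div_self hn0.ne'] at hsum
  rw [← hsum, Finset.sum_range, Finset.mul_sum, ← Finset.sum_sub_distrib]
  refine (Finset.abs_sum_le_sum_abs _ _).trans ?_
  have hle : ∀ i : Fin n, |(n : ℝ)⁻¹ * h (designPoint n i)
      - ∫ x in ((i : ℕ) : ℝ) / n..((i + 1 : ℕ) : ℝ) / n, h x| ≤ K / n * (n : ℝ)⁻¹ := fun i => by
    have hlen : ((i + 1 : ℕ) : ℝ) / n - ((i : ℕ) : ℝ) / n = (n : ℝ)⁻¹ := by
      push_cast; field_simp; ring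
    have hconst : (n : ℝ)⁻¹ * h (designPoint n i)
        = ∫ _ in ((i : ℕ) : ℝ) / n..((i + 1 : ℕ) : ℝ) / n, h (designPoint n i) := by
      rw [intervalIntegral.integral_const, hlen, smul_eq_mul]
    rw [hconst, ← intervalIntegral.integral_sub intervalIntegrable_const
      (hh.continuous.intervalIntegrable _ _)]
    have hb : ∀ x ∈ uIoc (((i : ℕ) : ℝ) / n) (((i + 1 : ℕ) : ℝ) / n),
        ‖h (designPoint n i) - h x‖ ≤ K / n := fun x hx => by
      have hd : designPoint n i = ((i + 1 : ℕ) : ℝ) / n := by simp [designPoint]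
      rw [uIoc_of_le (by linarith [inv_pos.2 hn0])] at hx
      refine (hh.dist_le_mul _ _).trans ?_
      rw [Real.dist_eq, hd, abs_of_nonneg (by linarith [hx.2]), div_eq_mul_inv (K : ℝ)]
      exact mul_le_mul_of_nonneg_left (by linarith [hx.1]) K.coe_nonneg
    have := intervalIntegral.norm_integral_le_of_norm_le_const hb
    rwa [hlen, abs_of_pos (inv_pos.2 hn0)] at this
  refine (Finset.sum_le_sum fun i _ => hle i).trans_eq ?_
  rw [Finset.sum_const, Finset.card_univ, Fintype.card_fin, nsmul_eq_mul]
  field_simp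

theorem abs_mean_le {n : ℕ} (hn : 1 ≤ n) {a : Fin n → ℝ} {B : ℝ} (ha : ∀ i, |a i| ≤ B) :
    |(n : ℝ)⁻¹ * ∑ i, a i| ≤ B := by
  have hn0 : (0 : ℝ) < n := by exact_mod_cast hn
  rw [abs_mul, abs_of_pos (inv_pos.2 hn0), inv_mul_le_iff₀ hn0]
  refine (Finset.abs_sum_le_sum_abs _ _).trans ((Finset.sum_le_sum fun i _ => ha i).trans_eq ?_)
  rw [Finset.sum_const, Finset.card_univ, Fintype.card_fin, nsmul_eq_mul]

section

variable {f φ : ℝ → ℝ}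

theorem integral_rankScore_mul_sub (hf : IsTemplate f) (hφ : IsNoiseDensity φ) (t θ : ℝ) :
    ∫ x in (0 : ℝ)..1, rankScore f φ (f (x - t)) * (f (x - θ) - f (x - t))
      = crossCorr f φ (θ - t) - crossCorr f φ 0 := by
  have hG := continuous_rankScore_comp hf hφ
  have hfc := hf.continuous
  have hper : Function.Periodic (fun x => rankScore f φ (f x) * (f (x - (θ - t)) - f x)) 1 :=
    fun x => by simp only [hf.periodic x, add_sub_right_comm x 1, hf.periodic (x - (θ - t))]
  have h := integral_zero_one_comp_add hper (-t)
  simp only [← sub_eq_add_neg] at h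
  have h2 : ∀ x, x - t - (θ - t) = x - θ := fun x => by ring
  simp only [h2] at h
  rw [h, crossCorr, crossCorr, ← intervalIntegral.integral_sub]
  · simp only [mul_sub, sub_zero]
  · exact Continuous.intervalIntegrable (by fun_prop) _ _
  · exact Continuous.intervalIntegrable (by fun_prop) _ _

/-- Both the inner average over j and the outer one over i are Riemann sums of Lipschitz functions,
with constants independent of t and θ. The diagonal of p is left free because an observation is
always at most itself, so its pair probability is not given by `noiseCDF₂`. One such entry per row
costs 1/n. -/
theorem exists_mean_score_le (hf : IsTemplate f) (hφ : IsNoiseDensity φ) :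
    ∃ C₁, 0 ≤ C₁ ∧ ∀ n : ℕ, 1 ≤ n → ∀ t θ : ℝ, ∀ p : Fin n → Fin n → ℝ,
      (∀ i j, p i j ∈ Icc (0 : ℝ) 1) →
      (∀ i j, i ≠ j → p i j =
        noiseCDF₂ φ (f (designPoint n i - t) - f (designPoint n j - t))) →
      (n : ℝ)⁻¹ * ∑ i, (f (designPoint n i - θ) - f (designPoint n i - t)) *
          ((n : ℝ)⁻¹ * ∑ j, p i j)
        ≤ crossCorr f φ (θ - t) - crossCorr f φ 0 + C₁ / n := by
  obtain ⟨L, hL⟩ := hf.lipschitz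
  obtain ⟨C, hC⟩ := hφ.bounded
  obtain ⟨B, hB⟩ := hf.exists_bound
  have hB0 : 0 ≤ B := (abs_nonneg _).trans (hB 0)
  have hC0 := hφ.bound_nonneg hC
  set Cn := C.toNNReal
  set Bn := B.toNNReal
  have hBn : (Bn : ℝ) = B := Real.coe_toNNReal _ hB0
  -- The first summand is the bound 2B on the weights times the inner error (1 for the diagonal, Cn
  -- * L for the Riemann sum). The second is the Lipschitz constant of the outer integrand.
  refine ⟨2 * B * (1 + Cn * L) + ((2 * L + 2 * Bn * (Cn * L) : NNReal) : ℝ), by positivity,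
    fun n hn t θ p hp hpΦ => ?_⟩
  have hn0 : (0 : ℝ) < n := by exact_mod_cast hn
  have hLt : ∀ s, LipschitzWith L fun x => f (x - s) := fun s =>
    LipschitzWith.of_dist_le_mul fun x y => by
      simpa only [dist_sub_right] using hL.dist_le_mul (x - s) (y - s)
  have hw : ∀ x, |f (x - θ) - f (x - t)| ≤ 2 * B := fun x =>
    (abs_sub _ _).trans (by linarith [hB (x - θ), hB (x - t)])
  have hinner : ∀ i, |(n : ℝ)⁻¹ * ∑ j, p i j - rankScore f φ (f (designPoint n i - t))|
      ≤ (1 + Cn * L) / n := fun i => by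
    set s := f (designPoint n i - t)
    have hlip : LipschitzWith (Cn * L) fun x => noiseCDF₂ φ (s - f (x - t)) :=
      (noiseCDF₂_lipschitz hφ hC).comp <| LipschitzWith.of_dist_le_mul fun x y => by
        rw [dist_sub_left]; exact (hLt t).dist_le_mul x y
    have h1 := abs_mean_designPoint_sub_integral_le hlip hn
    have hper : Function.Periodic (fun x => noiseCDF₂ φ (s - f x)) 1 := fun x => by
      simp only [hf.periodic x]
    have h2 := integral_zero_one_comp_add hper (-t)
    simp only [← sub_eq_add_neg] at h2
    rw [h2] at h1
    have h3 : |(n : ℝ)⁻¹ * ∑ j, p i j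
        - (n : ℝ)⁻¹ * ∑ j, noiseCDF₂ φ (s - f (designPoint n j - t))| ≤ 1 / n := by
      rw [← mul_sub, ← Finset.sum_sub_distrib, Finset.sum_eq_single i
        (fun j _ hj => by rw [hpΦ i j hj.symm, sub_self]) (by simp), abs_mul,
        abs_of_pos (inv_pos.2 hn0), one_div]
      refine mul_le_of_le_one_right (inv_pos.2 hn0).le (abs_le.2 ⟨?_, ?_⟩)
      · linarith [(hp i i).1, noiseCDF₂_le_one hφ (s - f (designPoint n i - t))]
      · linarith [(hp i i).2, noiseCDF₂_nonneg hφ (s - f (designPoint n i - t))]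
    refine (abs_sub_le _ _ _).trans ((add_le_add h3 h1).trans_eq ?_)
    rw [← add_div, NNReal.coe_mul]
  have houter : LipschitzWith (2 * L + 2 * Bn * (Cn * L))
      fun x => rankScore f φ (f (x - t)) * (f (x - θ) - f (x - t)) := by
    refine LipschitzWith.of_dist_le_mul fun x y => ?_
    have h1 := ((rankScore_lipschitz hf hφ hC).comp (hLt t)).dist_le_mul x y
    have h2 := (hLt t).dist_le_mul x y
    have h3 := (hLt θ).dist_le_mul x y
    simp only [Real.dist_eq, Function.comp_def] at h1 h2 h3 ⊢
    have e : rankScore f φ (f (x - t)) * (f (x - θ) - f (x - t))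
        - rankScore f φ (f (y - t)) * (f (y - θ) - f (y - t))
        = rankScore f φ (f (x - t)) * ((f (x - θ) - f (y - θ)) - (f (x - t) - f (y - t)))
        + (rankScore f φ (f (x - t)) - rankScore f φ (f (y - t))) * (f (y - θ) - f (y - t)) := by
      ring
    rw [e]
    refine (abs_add_le _ _).trans ?_
    rw [abs_mul, abs_mul, abs_of_nonneg (rankScore_nonneg hφ _)]
    have h4 : |(f (x - θ) - f (y - θ)) - (f (x - t) - f (y - t))| ≤ 2 * L * |x - y| :=
      (abs_sub _ _).trans (by linarith)
    have h5 := mul_le_mul h1 (hw y) (abs_nonneg _) (by positivity)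
    have h6 := (mul_le_of_le_one_left (abs_nonneg _)
      (rankScore_le_one hf hφ (f (x - t)))).trans h4
    refine (add_le_add h6 h5).trans_eq ?_
    push_cast
    rw [hBn]
    ring
  have h1 := abs_mean_designPoint_sub_integral_le houter hn
  rw [integral_rankScore_mul_sub hf hφ] at h1
  have h2 : |(n : ℝ)⁻¹ * ∑ i, (f (designPoint n i - θ) - f (designPoint n i - t)) *
      ((n : ℝ)⁻¹ * ∑ j, p i j - rankScore f φ (f (designPoint n i - t)))|
      ≤ 2 * B * ((1 + Cn * L) / n) :=
    abs_mean_le hn fun i => by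
      rw [abs_mul]
      exact mul_le_mul (hw _) (hinner i) (abs_nonneg _) (by positivity)
  simp only [mul_sub, Finset.sum_sub_distrib] at h1 h2 ⊢
  simp only [sub_mul, Finset.sum_sub_distrib, mul_sub] at h1 h2 ⊢
  have h3 := (abs_le.1 h1).2
  have h4 := (abs_le.1 h2).2
  simp only [mul_comm (rankScore f φ _)] at h3
  rw [add_div, mul_div_assoc]
  linarith

end

/-! ### Rank indicators and the law of the sample -/

/-- The indicator that observation `j` is at most observation `i`. -/
def rankIndicator {n : ℕ} (i j : Fin n) (y : Fin n → ℝ) : ℝ := if y j ≤ y i then 1 else 0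

theorem measurable_rankIndicator {n : ℕ} (i j : Fin n) : Measurable (rankIndicator i j) :=
  Measurable.ite (measurableSet_le (measurable_pi_apply j) (measurable_pi_apply i))
    measurable_const measurable_const

theorem rankIndicator_nonneg {n : ℕ} (i j : Fin n) (y : Fin n → ℝ) : 0 ≤ rankIndicator i j y := by
  unfold rankIndicator; split_ifs <;> norm_num

theorem rankIndicator_le_one {n : ℕ} (i j : Fin n) (y : Fin n → ℝ) : rankIndicator i j y ≤ 1 := by
  unfold rankIndicator; split_ifs <;> norm_num

theorem rank_eq_sum {n : ℕ} (y : Fin n → ℝ) (i : Fin n) :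
    (rank y i : ℝ) = ∑ j, rankIndicator i j y := by
  simp [rank, rankIndicator, Finset.sum_boole]

section Law

variable {f φ : ℝ → ℝ}

theorem isProbabilityMeasure_noiseLaw (hφ : IsNoiseDensity φ) :
    IsProbabilityMeasure (noiseLaw φ) := by
  refine ⟨?_⟩
  rw [noiseLaw, withDensity_apply _ MeasurableSet.univ, Measure.restrict_univ,
    ← ofReal_integral_eq_lintegral_ofReal hφ.integrable (Eventually.of_forall hφ.nonneg),
    hφ.integral_eq_one, ENNReal.ofReal_one]

/-- The law of one observation with signal `a`. -/
def shiftedLaw (φ : ℝ → ℝ) (a : ℝ) : Measure ℝ := (noiseLaw φ).map (a + ·)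

theorem isProbabilityMeasure_shiftedLaw (hφ : IsNoiseDensity φ) (a : ℝ) :
    IsProbabilityMeasure (shiftedLaw φ a) :=
  have := isProbabilityMeasure_noiseLaw hφ
  Measure.isProbabilityMeasure_map (measurable_const_add a).aemeasurable

theorem sampleLaw_eq_pi (hφ : IsNoiseDensity φ) (n : ℕ) (θ : ℝ) :
    sampleLaw f φ n θ = Measure.pi fun i => shiftedLaw φ (f (designPoint n i - θ)) := by
  have := isProbabilityMeasure_noiseLaw hφ
  have := fun i => isProbabilityMeasure_shiftedLaw hφ (f (designPoint n i - θ))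
  have : ∀ i : Fin n, SigmaFinite
      (Measure.map (f (designPoint n i - θ) + ·) (noiseLaw φ)) := fun i =>
    inferInstanceAs (SigmaFinite (shiftedLaw φ _))
  exact Measure.pi_map_pi (f := fun (i : Fin n) z => f (designPoint n i - θ) + z)
    fun i => (measurable_const_add _).aemeasurable

theorem isProbabilityMeasure_sampleLaw (hφ : IsNoiseDensity φ) (n : ℕ) (θ : ℝ) :
    IsProbabilityMeasure (sampleLaw f φ n θ) := by
  have := fun i => isProbabilityMeasure_shiftedLaw hφ (f (designPoint n i - θ))
  rw [sampleLaw_eq_pi hφ]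
  infer_instance

theorem iIndepFun_sampleLaw (hφ : IsNoiseDensity φ) (n : ℕ) (θ : ℝ) :
    iIndepFun (fun (i : Fin n) (y : Fin n → ℝ) => y i) (sampleLaw f φ n θ) := by
  have := fun i => isProbabilityMeasure_shiftedLaw hφ (f (designPoint n i - θ))
  rw [sampleLaw_eq_pi hφ]
  exact iIndepFun_pi (X := fun _ x => x) fun i => aemeasurable_id

theorem map_eval_sampleLaw (hφ : IsNoiseDensity φ) (n : ℕ) (θ : ℝ) (i : Fin n) :
    (sampleLaw f φ n θ).map (fun y => y i) = shiftedLaw φ (f (designPoint n i - θ)) := by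
  have := fun i => isProbabilityMeasure_shiftedLaw hφ (f (designPoint n i - θ))
  rw [sampleLaw_eq_pi hφ]
  exact (measurePreserving_eval (fun i => shiftedLaw φ (f (designPoint n i - θ))) i).map_eq

theorem shiftedLaw_real_Iic (hφ : IsNoiseDensity φ) (a t : ℝ) :
    (shiftedLaw φ a).real (Iic t) = noiseCDF φ (t - a) := by
  have : (a + ·) ⁻¹' Iic t = Iic (t - a) := by
    ext z; simp [le_sub_iff_add_le']
  rw [measureReal_def, shiftedLaw, Measure.map_apply (measurable_const_add a) measurableSet_Iic,
    this, noiseLaw, withDensity_apply _ measurableSet_Iic,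
    ← ofReal_integral_eq_lintegral_ofReal hφ.integrable.integrableOn
      (Eventually.of_forall hφ.nonneg)]
  exact ENNReal.toReal_ofReal (noiseCDF_nonneg hφ _)

theorem integral_shiftedLaw (hφ : IsNoiseDensity φ) (a : ℝ) {h : ℝ → ℝ} (hh : Measurable h) :
    ∫ y, h y ∂shiftedLaw φ a = ∫ z, h (a + z) * φ z := by
  rw [shiftedLaw, integral_map (measurable_const_add a).aemeasurable hh.aestronglyMeasurable,
    noiseLaw, integral_withDensity_eq_integral_toReal_smul hφ.measurable.ennreal_ofReal
      (Eventually.of_forall fun _ => ENNReal.ofReal_lt_top)]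
  refine integral_congr_ae (Eventually.of_forall fun z => ?_)
  simp only [ENNReal.toReal_ofReal (hφ.nonneg z), smul_eq_mul, mul_comm]

theorem integral_rankIndicator (hφ : IsNoiseDensity φ) (n : ℕ) (θ : ℝ) {i j : Fin n}
    (hij : i ≠ j) :
    ∫ y, rankIndicator i j y ∂sampleLaw f φ n θ
      = noiseCDF₂ φ (f (designPoint n i - θ) - f (designPoint n j - θ)) := by
  have := isProbabilityMeasure_sampleLaw (f := f) hφ n θ
  have := fun i => isProbabilityMeasure_shiftedLaw hφ (f (designPoint n i - θ))
  have hmeas : Measurable fun q : ℝ × ℝ => if q.2 ≤ q.1 then (1 : ℝ) else 0 :=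
    Measurable.ite (measurableSet_le measurable_snd measurable_fst)
      measurable_const measurable_const
  have hind := ((iIndepFun_sampleLaw (f := f) hφ n θ).indepFun hij)
  rw [indepFun_iff_map_prod_eq_prod_map_map (measurable_pi_apply i).aemeasurable
    (measurable_pi_apply j).aemeasurable, map_eval_sampleLaw hφ, map_eval_sampleLaw hφ] at hind
  have h1 : ∫ y, rankIndicator i j y ∂sampleLaw f φ n θ
      = ∫ q, (if q.2 ≤ q.1 then (1 : ℝ) else 0) ∂((sampleLaw f φ n θ).map fun y => (y i, y j)) := by
    rw [integral_map ((measurable_pi_apply i).prodMk (measurable_pi_apply j)).aemeasurable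
      hmeas.aestronglyMeasurable]
    rfl
  rw [h1, hind, integral_prod]
  · have h2 : ∀ x, ∫ y, (if y ≤ x then (1 : ℝ) else 0) ∂shiftedLaw φ (f (designPoint n j - θ))
        = noiseCDF φ (x - f (designPoint n j - θ)) := fun x => by
      rw [← shiftedLaw_real_Iic hφ, ← integral_indicator_one measurableSet_Iic]
      rfl
    obtain ⟨C, hC⟩ := hφ.bounded
    simp only [h2]
    have hm : Measurable fun x => noiseCDF φ (x - f (designPoint n j - θ)) :=
      (noiseCDF_lipschitz hφ hC).continuous.measurable.comp (measurable_id.sub_const _)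
    rw [integral_shiftedLaw hφ _ hm, noiseCDF₂]
    simp only [add_sub_right_comm]
  · refine Integrable.of_bound hmeas.aestronglyMeasurable 1 (Eventually.of_forall fun q => ?_)
    split_ifs <;> simp

end Law

/-! ### Second moment of the centred rank slope -/

/-- In the expanded square only quadruples in which {i, j} meets {k, l} survive. There are at most
4n³ of them, one family of n³ for each possible coincidence, and each contributes at most L². -/
theorem integral_sum_sq_le {Ω : Type*} [MeasurableSpace Ω] {P : Measure Ω} [IsProbabilityMeasure P]
    {n : ℕ} {ξ : Fin n → Fin n → Ω → ℝ} (hm : ∀ i j, Measurable (ξ i j))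
    (hb : ∀ i j ω, |ξ i j ω| ≤ 1)
    (h0 : ∀ i j k l, i ≠ k → i ≠ l → j ≠ k → j ≠ l → ∫ ω, ξ i j ω * ξ k l ω ∂P = 0)
    {a : Fin n → ℝ} {L : ℝ} (ha : ∀ i, |a i| ≤ L) :
    ∫ ω, (∑ i, ∑ j, a i * ξ i j ω) ^ 2 ∂P ≤ 4 * L ^ 2 * n ^ 3 := by
  have hint : ∀ i j k l, Integrable (fun ω => (a i * ξ i j ω) * (a k * ξ k l ω)) P :=
    fun i j k l => by
      refine Integrable.of_bound (((hm i j).const_mul _).mul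
        ((hm k l).const_mul _)).aestronglyMeasurable (L * L) (Eventually.of_forall fun ω => ?_)
      rw [norm_mul, norm_mul, norm_mul]
      have hL : 0 ≤ L := (abs_nonneg _).trans (ha i)
      have h1 : ∀ i j, ‖a i‖ * ‖ξ i j ω‖ ≤ L := fun i j =>
        (mul_le_mul (ha i) (hb i j ω) (abs_nonneg _) hL).trans_eq (mul_one L)
      exact mul_le_mul (h1 i j) (h1 k l) (by positivity) hL
  have hexp : ∀ ω, (∑ i, ∑ j, a i * ξ i j ω) ^ 2
      = ∑ i, ∑ j, ∑ k, ∑ l, (a i * ξ i j ω) * (a k * ξ k l ω) := fun ω => by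
    rw [sq]
    simp only [Finset.sum_mul]
    simp only [Finset.mul_sum]
  have hterm : ∀ i j k l, ∫ ω, (a i * ξ i j ω) * (a k * ξ k l ω) ∂P
      ≤ L ^ 2 * ((if i = k then 1 else 0) + (if i = l then 1 else 0)
        + (if j = k then 1 else 0) + (if j = l then 1 else 0)) := fun i j k l => by
    have hL : 0 ≤ L := (abs_nonneg _).trans (ha i)
    by_cases hdisj : i ≠ k ∧ i ≠ l ∧ j ≠ k ∧ j ≠ l
    · obtain ⟨h1, h2, h3, h4⟩ := hdisj
      have : ∀ ω, (a i * ξ i j ω) * (a k * ξ k l ω) = (a i * a k) * (ξ i j ω * ξ k l ω) :=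
        fun ω => by ring
      simp only [this]
      rw [integral_const_mul, h0 i j k l h1 h2 h3 h4]
      simp [h1, h2, h3, h4]
    · have h1 : ∫ ω, (a i * ξ i j ω) * (a k * ξ k l ω) ∂P ≤ ∫ _, L ^ 2 ∂P := by
        refine integral_mono (hint i j k l) (integrable_const _) fun ω => ?_
        have h2 : ∀ i j, |a i * ξ i j ω| ≤ L := fun i j => by
          rw [abs_mul]
          exact (mul_le_mul (ha i) (hb i j ω) (abs_nonneg _) hL).trans_eq (mul_one L)
        refine (le_abs_self _).trans ?_
        rw [abs_mul, sq]
        exact mul_le_mul (h2 i j) (h2 k l) (abs_nonneg _) hL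
      rw [integral_const, probReal_univ, one_smul] at h1
      refine h1.trans (le_mul_of_one_le_right (sq_nonneg L) ?_)
      have h3 : i = k ∨ i = l ∨ j = k ∨ j = l := by tauto
      have nn : ∀ x y : Fin n, (0 : ℝ) ≤ if x = y then 1 else 0 := fun x y => by
        split_ifs <;> norm_num
      rcases h3 with h | h | h | h
      · rw [if_pos h]; linarith [nn i l, nn j k, nn j l]
      · rw [if_pos h]; linarith [nn i k, nn j k, nn j l]
      · rw [if_pos h]; linarith [nn i k, nn i l, nn j l]
      · rw [if_pos h]; linarith [nn i k, nn i l, nn j k]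
  simp only [hexp]
  rw [integral_finsetSum _ fun i _ => integrable_finsetSum _ fun j _ =>
    integrable_finsetSum _ fun k _ => integrable_finsetSum _ fun l _ => hint i j k l]
  calc ∑ i, ∫ ω, ∑ j, ∑ k, ∑ l, (a i * ξ i j ω) * (a k * ξ k l ω) ∂P
      = ∑ i, ∑ j, ∑ k, ∑ l, ∫ ω, (a i * ξ i j ω) * (a k * ξ k l ω) ∂P := by
        refine Finset.sum_congr rfl fun i _ => ?_
        rw [integral_finsetSum _ fun j _ => integrable_finsetSum _ fun k _ =>
          integrable_finsetSum _ fun l _ => hint i j k l]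
        refine Finset.sum_congr rfl fun j _ => ?_
        rw [integral_finsetSum _ fun k _ => integrable_finsetSum _ fun l _ => hint i j k l]
        refine Finset.sum_congr rfl fun k _ => ?_
        rw [integral_finsetSum _ fun l _ => hint i j k l]
    _ ≤ ∑ i : Fin n, ∑ j : Fin n, ∑ k : Fin n, ∑ l : Fin n,
        L ^ 2 * ((if i = k then 1 else 0) + (if i = l then 1 else 0)
          + (if j = k then 1 else 0) + (if j = l then 1 else 0)) :=
        Finset.sum_le_sum fun i _ => Finset.sum_le_sum fun j _ =>
          Finset.sum_le_sum fun k _ => Finset.sum_le_sum fun l _ => hterm i j k l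
    _ = 4 * L ^ 2 * n ^ 3 := by
        simp only [← Finset.mul_sum, Finset.sum_add_distrib, Finset.sum_const, Finset.card_univ,
          Fintype.card_fin, Finset.sum_ite_eq, Finset.mem_univ, if_true, nsmul_eq_mul, mul_one]
        ring

/-- The probability that observation `j` is at most observation `i`, under the shift `t`. -/
def pairProb (f φ : ℝ → ℝ) (n : ℕ) (t : ℝ) (i j : Fin n) : ℝ :=
  ∫ y, rankIndicator i j y ∂sampleLaw f φ n t

/-- The centred normalized rank of observation `i`. -/
def centredRank (f φ : ℝ → ℝ) (n : ℕ) (t : ℝ) (i : Fin n) (y : Fin n → ℝ) : ℝ :=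
  (n : ℝ)⁻¹ * ∑ j, (rankIndicator i j y - pairProb f φ n t i j)

/-- The negative of the derivative, in the candidate shift `u`, of the centred normalized rank
criterion. -/
def slopeNoise (f φ : ℝ → ℝ) (n : ℕ) (t u : ℝ) (y : Fin n → ℝ) : ℝ :=
  (n : ℝ)⁻¹ * ∑ i, deriv f (designPoint n i - u) * centredRank f φ n t i y

section

variable {f φ : ℝ → ℝ} {L : NNReal}

theorem integrable_rankIndicator {n : ℕ} (i j : Fin n) (P : Measure (Fin n → ℝ))
    [IsFiniteMeasure P] : Integrable (rankIndicator i j) P :=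
  Integrable.of_bound (measurable_rankIndicator i j).aestronglyMeasurable 1
    (Eventually.of_forall fun y => by
      rw [Real.norm_of_nonneg (rankIndicator_nonneg i j y)]; exact rankIndicator_le_one i j y)

theorem pairProb_mem_Icc (hφ : IsNoiseDensity φ) (n : ℕ) (t : ℝ) (i j : Fin n) :
    pairProb f φ n t i j ∈ Icc (0 : ℝ) 1 := by
  have := isProbabilityMeasure_sampleLaw (f := f) hφ n t
  refine ⟨integral_nonneg fun y => rankIndicator_nonneg i j y, ?_⟩
  have := integral_mono (integrable_rankIndicator i j (sampleLaw f φ n t)) (integrable_const 1)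
    fun y => rankIndicator_le_one i j y
  rwa [integral_const, probReal_univ, one_smul] at this

theorem measurable_centredRank (n : ℕ) (t : ℝ) (i : Fin n) :
    Measurable (centredRank f φ n t i) :=
  (Finset.measurable_sum _ fun j _ => (measurable_rankIndicator i j).sub_const _).const_mul _

theorem measurable_slopeNoise (n : ℕ) (t : ℝ) :
    Measurable fun q : ℝ × (Fin n → ℝ) => slopeNoise f φ n t q.1 q.2 := by
  refine (Finset.measurable_sum _ fun i _ => ?_).const_mul _
  exact ((measurable_deriv f).comp (measurable_fst.const_sub _)).mul
    ((measurable_centredRank n t i).comp measurable_snd)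

theorem integral_centred_mul_centred (hφ : IsNoiseDensity φ) (n : ℕ) (t : ℝ) {i j k l : Fin n}
    (hik : i ≠ k) (hil : i ≠ l) (hjk : j ≠ k) (hjl : j ≠ l) :
    ∫ y, (rankIndicator i j y - pairProb f φ n t i j) *
      (rankIndicator k l y - pairProb f φ n t k l) ∂sampleLaw f φ n t = 0 := by
  have := isProbabilityMeasure_sampleLaw (f := f) hφ n t
  have hmeas : Measurable fun q : ℝ × ℝ => if q.2 ≤ q.1 then (1 : ℝ) else 0 :=
    Measurable.ite (measurableSet_le measurable_snd measurable_fst)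
      measurable_const measurable_const
  have hind := ((iIndepFun_sampleLaw (f := f) hφ n t).indepFun_prodMk_prodMk
    (fun i => measurable_pi_apply i) i j k l hik hil hjk hjl).comp
      (hmeas.sub_const (pairProb f φ n t i j)) (hmeas.sub_const (pairProb f φ n t k l))
  have hm : ∀ i j, AEStronglyMeasurable (fun y => rankIndicator i j y - pairProb f φ n t i j)
      (sampleLaw f φ n t) := fun i j =>
    ((measurable_rankIndicator i j).sub_const _).aestronglyMeasurable
  refine (hind.integral_mul_eq_mul_integral (hm i j) (hm k l)).trans ?_
  have h0 : ∫ y, (rankIndicator i j y - pairProb f φ n t i j) ∂sampleLaw f φ n t = 0 := by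
    rw [integral_sub (integrable_rankIndicator i j _) (integrable_const _), integral_const,
      probReal_univ, one_smul, pairProb, sub_self]
  exact (congrArg (· * _) h0).trans (zero_mul _)

theorem abs_rankIndicator_sub_pairProb_le (hφ : IsNoiseDensity φ) (n : ℕ) (t : ℝ) (i j : Fin n)
    (y : Fin n → ℝ) : |rankIndicator i j y - pairProb f φ n t i j| ≤ 1 := by
  have h1 := pairProb_mem_Icc (f := f) hφ n t i j
  have h2 := rankIndicator_nonneg i j y
  have h3 := rankIndicator_le_one i j y
  exact abs_le.2 ⟨by linarith [h1.2], by linarith [h1.1]⟩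

theorem measurable_slopeNoise_right (n : ℕ) (t u : ℝ) : Measurable (slopeNoise f φ n t u) :=
  Measurable.of_uncurry_left (f := slopeNoise f φ n t) (measurable_slopeNoise n t)

theorem measurable_slopeNoise_left (n : ℕ) (t : ℝ) (y : Fin n → ℝ) :
    Measurable fun u => slopeNoise f φ n t u y :=
  Measurable.of_uncurry_right (f := slopeNoise f φ n t) (measurable_slopeNoise n t)

theorem abs_slopeNoise_le (hφ : IsNoiseDensity φ) (hL : LipschitzWith L f) {n : ℕ}
    (hn : 1 ≤ n) (t u : ℝ) (y : Fin n → ℝ) : |slopeNoise f φ n t u y| ≤ L :=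
  abs_mean_le hn fun i => by
    rw [abs_mul]
    exact (mul_le_mul (abs_deriv_le hL _)
      (abs_mean_le hn fun j => abs_rankIndicator_sub_pairProb_le hφ n t i j y)
      (abs_nonneg _) L.coe_nonneg).trans_eq (mul_one _)

theorem slopeNoise_eq (n : ℕ) (t u : ℝ) (y : Fin n → ℝ) :
    slopeNoise f φ n t u y = ((n : ℝ)⁻¹) ^ 2 * ∑ i, ∑ j,
      deriv f (designPoint n i - u) * (rankIndicator i j y - pairProb f φ n t i j) := by
  simp only [slopeNoise, centredRank, Finset.mul_sum]
  refine Finset.sum_congr rfl fun i _ => Finset.sum_congr rfl fun j _ => ?_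
  ring

theorem integral_slopeNoise_sq_le (hφ : IsNoiseDensity φ) (hL : LipschitzWith L f) {n : ℕ}
    (hn : 1 ≤ n) (t u : ℝ) :
    ∫ y, slopeNoise f φ n t u y ^ 2 ∂sampleLaw f φ n t ≤ 4 * L ^ 2 / n := by
  have := isProbabilityMeasure_sampleLaw (f := f) hφ n t
  have hn0 : (0 : ℝ) < n := by exact_mod_cast hn
  have h := integral_sum_sq_le (P := sampleLaw f φ n t)
    (ξ := fun i j y => rankIndicator i j y - pairProb f φ n t i j)
    (fun i j => (measurable_rankIndicator i j).sub_const _)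
    (abs_rankIndicator_sub_pairProb_le hφ n t)
    (fun i j k l h1 h2 h3 h4 => integral_centred_mul_centred hφ n t h1 h2 h3 h4)
    (a := fun i => deriv f (designPoint n i - u)) (L := L) fun i => abs_deriv_le hL _
  have h2 : ∫ y, slopeNoise f φ n t u y ^ 2 ∂sampleLaw f φ n t
      ≤ (((n : ℝ)⁻¹) ^ 2) ^ 2 * (4 * L ^ 2 * n ^ 3) := by
    simp only [slopeNoise_eq, mul_pow]
    rw [integral_const_mul]
    exact mul_le_mul_of_nonneg_left h (by positivity)
  refine h2.trans_eq ?_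
  field_simp

/-- Taken at s = √n, this turns a second moment of order 1/n into a first moment of order 1/√n. -/
theorem abs_le_mul_sq_add {s : ℝ} (hs : 0 < s) (v : ℝ) : |v| ≤ s * v ^ 2 + 1 / s := by
  rw [← sq_abs]
  have h1 : s * |v| ^ 2 + 1 / s - |v| = ((s * |v| - 1 / 2) ^ 2 + 3 / 4) / s := by
    field_simp
    ring
  have h2 : 0 ≤ ((s * |v| - 1 / 2) ^ 2 + 3 / 4) / s := by positivity
  linarith

theorem lintegral_slopeNoise_le (hφ : IsNoiseDensity φ) (hL : LipschitzWith L f) {n : ℕ}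
    (hn : 1 ≤ n) (t u : ℝ) :
    ∫⁻ y, ‖slopeNoise f φ n t u y‖ₑ ∂sampleLaw f φ n t
      ≤ ENNReal.ofReal ((4 * L ^ 2 + 1) / √n) := by
  have := isProbabilityMeasure_sampleLaw (f := f) hφ n t
  have hn0 : (0 : ℝ) < n := by exact_mod_cast hn
  have hs : 0 < √(n : ℝ) := Real.sqrt_pos.2 hn0
  have hss : √(n : ℝ) ^ 2 = n := Real.sq_sqrt hn0.le
  have hVm := measurable_slopeNoise_right (f := f) (φ := φ) n t u
  have hVb := abs_slopeNoise_le hφ hL hn t u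
  have hVi : Integrable (slopeNoise f φ n t u) (sampleLaw f φ n t) :=
    Integrable.of_bound hVm.aestronglyMeasurable L (Eventually.of_forall hVb)
  have hV2i : Integrable (fun y => slopeNoise f φ n t u y ^ 2) (sampleLaw f φ n t) := by
    refine Integrable.of_bound (hVm.pow_const 2).aestronglyMeasurable (L ^ 2)
      (Eventually.of_forall fun y => ?_)
    rw [norm_pow]
    exact pow_le_pow_left₀ (norm_nonneg _) (hVb y) 2
  rw [← ofReal_integral_norm_eq_lintegral_enorm hVi]
  refine ENNReal.ofReal_le_ofReal ?_
  have hadd : ∫ y, (√n * slopeNoise f φ n t u y ^ 2 + 1 / √n) ∂sampleLaw f φ n t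
      = √n * ∫ y, slopeNoise f φ n t u y ^ 2 ∂sampleLaw f φ n t + 1 / √n := by
    rw [integral_add (hV2i.const_mul _) (integrable_const _), integral_const_mul,
      integral_const, probReal_univ, one_smul]
  calc ∫ y, ‖slopeNoise f φ n t u y‖ ∂sampleLaw f φ n t
      ≤ ∫ y, (√n * slopeNoise f φ n t u y ^ 2 + 1 / √n) ∂sampleLaw f φ n t :=
        integral_mono hVi.norm ((hV2i.const_mul _).add (integrable_const _))
          fun y => abs_le_mul_sq_add hs _
    _ ≤ √n * (4 * L ^ 2 / n) + 1 / √n := by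
        rw [hadd]
        exact add_le_add_left
          (mul_le_mul_of_nonneg_left (integral_slopeNoise_sq_le hφ hL hn t u) hs.le) _
    _ = (4 * L ^ 2 + 1) / √n := by
        nth_rewrite 2 [← hss]
        field_simp

/-- The fundamental theorem of calculus for the Lipschitz template. The sign arises because the
shift enters f negatively. -/
theorem mean_sub_mul_centredRank (hL : LipschitzWith L f) (n : ℕ) (t θ : ℝ) (y : Fin n → ℝ) :
    (n : ℝ)⁻¹ * ∑ i, (f (designPoint n i - θ) - f (designPoint n i - t)) * centredRank f φ n t i y
      = -∫ u in t..θ, slopeNoise f φ n t u y := by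
  have hi : ∀ i, IntervalIntegrable
      (fun u => deriv f (designPoint n i - u) * centredRank f φ n t i y) volume t θ := fun i =>
    IntervalIntegrable.mul_const (by
      simpa using (intervalIntegrable_deriv_of_lipschitz hL (designPoint n i - t)
        (designPoint n i - θ)).comp_sub_left (designPoint n i)) _
  simp only [slopeNoise]
  rw [intervalIntegral.integral_const_mul, intervalIntegral.integral_finsetSum fun i _ => hi i,
    ← mul_neg, ← Finset.sum_neg_distrib]
  congr 1
  refine Finset.sum_congr rfl fun i _ => ?_
  rw [intervalIntegral.integral_mul_const, intervalIntegral.integral_comp_sub_left (deriv f),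
    integral_deriv_of_lipschitz hL]
  ring

/-! ### Control of the noise at all scales and the rate of R-estimators -/

/-- A weighted integral of the slope noise, which controls the increments of the centred rank
criterion at all scales from `a` on. -/
def weightedNoise (f φ : ℝ → ℝ) (n : ℕ) (t a : ℝ) (y : Fin n → ℝ) : ENNReal :=
  ∫⁻ u, ‖slopeNoise f φ n t u y‖ₑ * ENNReal.ofReal (((u - t) ^ 2 + a ^ 2)⁻¹)

theorem measurable_weightedNoise (n : ℕ) (t a : ℝ) : Measurable (weightedNoise f φ n t a) := by
  refine Measurable.lintegral_prod_left' (f := fun q : ℝ × (Fin n → ℝ) =>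
    ‖slopeNoise f φ n t q.1 q.2‖ₑ * ENNReal.ofReal (((q.1 - t) ^ 2 + a ^ 2)⁻¹)) ?_
  exact (measurable_slopeNoise n t).enorm.mul (by fun_prop)

theorem lintegral_inv_sq_add_sq {a : ℝ} (ha : 0 < a) (t : ℝ) :
    ∫⁻ u, ENNReal.ofReal (((u - t) ^ 2 + a ^ 2)⁻¹) = ENNReal.ofReal (Real.pi / a) := by
  have h : ∀ u, ((u - t) ^ 2 + a ^ 2)⁻¹ = (a ^ 2)⁻¹ * (1 + ((u - t) / a) ^ 2)⁻¹ := fun u => by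
    rw [← mul_inv]; congr 1; field_simp; ring
  have hi : Integrable fun u : ℝ => ((u - t) ^ 2 + a ^ 2)⁻¹ := by
    simp only [h]
    exact ((integrable_inv_one_add_sq.comp_div ha.ne').comp_sub_right t).const_mul _
  rw [← ofReal_integral_eq_lintegral_ofReal hi (Eventually.of_forall fun u => by positivity)]
  congr 1
  simp only [h]
  rw [integral_const_mul, integral_sub_right_eq_self (fun u => (1 + (u / a) ^ 2)⁻¹) t,
    Measure.integral_comp_div (fun u : ℝ => (1 + u ^ 2)⁻¹) a, integral_univ_inv_one_add_sq,
    abs_of_pos ha, smul_eq_mul]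
  field_simp

/-- By Tonelli only the pointwise-in-u bound on the mean absolute slope is needed. The Cauchy kernel
has total mass π/a. -/
theorem lintegral_weightedNoise_le (hφ : IsNoiseDensity φ) (hL : LipschitzWith L f) {n : ℕ}
    (hn : 1 ≤ n) (t : ℝ) {a : ℝ} (ha : 0 < a) :
    ∫⁻ y, weightedNoise f φ n t a y ∂sampleLaw f φ n t
      ≤ ENNReal.ofReal ((4 * L ^ 2 + 1) / √n * (Real.pi / a)) := by
  have := isProbabilityMeasure_sampleLaw (f := f) hφ n t
  unfold weightedNoise
  rw [lintegral_lintegral_swap]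
  · have hm : ∀ u, Measurable fun y => ‖slopeNoise f φ n t u y‖ₑ := fun u =>
      (measurable_slopeNoise_right n t u).enorm
    simp only [lintegral_mul_const _ (hm _)]
    refine (lintegral_mono fun u =>
      mul_le_mul_left (lintegral_slopeNoise_le hφ hL hn t u) _).trans_eq ?_
    rw [lintegral_const_mul _ (by fun_prop), lintegral_inv_sq_add_sq ha,
      ← ENNReal.ofReal_mul (by positivity)]
  · exact (((measurable_slopeNoise n t).comp measurable_swap).enorm.mul
      (by fun_prop)).aemeasurable

/-- Between t and θ the weight is at least 1/(2(θ - t)²), since both |u - t| and a are at most |θ -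
t|. A fluctuation of size c(θ - t)² therefore contributes c/2, whatever the scale of |θ - t|. -/
theorem le_weightedNoise (hL : LipschitzWith L f) (n : ℕ) (t θ : ℝ) (y : Fin n → ℝ) {a c : ℝ}
    (ha : 0 < a) (had : a ≤ |θ - t|)
    (hW : c * (θ - t) ^ 2 ≤ (n : ℝ)⁻¹ *
      ∑ i, (f (designPoint n i - θ) - f (designPoint n i - t)) * centredRank f φ n t i y) :
    ENNReal.ofReal (c / 2) ≤ weightedNoise f φ n t a y := by
  have hd : 0 < |θ - t| := ha.trans_le had
  rw [mean_sub_mul_centredRank hL] at hW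
  have hw : ∀ u ∈ uIoc t θ, (2 * (θ - t) ^ 2)⁻¹ ≤ ((u - t) ^ 2 + a ^ 2)⁻¹ := fun u hu => by
    have h1 : |u - t| ≤ |θ - t| := abs_sub_left_of_mem_uIcc (uIoc_subset_uIcc hu)
    have h2 := sq_le_sq' (by linarith [abs_nonneg (u - t)]) h1
    have h3 := pow_le_pow_left₀ ha.le had 2
    rw [sq_abs] at h2 h3
    rw [sq_abs] at h2
    exact inv_anti₀ (by positivity) (by linarith)
  calc ENNReal.ofReal (c / 2)
      ≤ ENNReal.ofReal (|∫ u in t..θ, slopeNoise f φ n t u y| * (2 * (θ - t) ^ 2)⁻¹) := by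
        refine ENNReal.ofReal_le_ofReal ?_
        have h1 := hW.trans ((le_abs_self _).trans_eq (abs_neg _))
        have h2 : 0 < (θ - t) ^ 2 := by rw [← sq_abs]; positivity
        rw [← div_eq_mul_inv, le_div_iff₀ (by positivity)]
        linarith
    _ = ‖∫ u in uIoc t θ, slopeNoise f φ n t u y‖ₑ * ENNReal.ofReal ((2 * (θ - t) ^ 2)⁻¹) := by
        rw [ENNReal.ofReal_mul (abs_nonneg _), intervalIntegral.abs_integral_eq_abs_integral_uIoc,
          ← Real.enorm_eq_ofReal_abs]
    _ ≤ (∫⁻ u in uIoc t θ, ‖slopeNoise f φ n t u y‖ₑ) * ENNReal.ofReal ((2 * (θ - t) ^ 2)⁻¹) :=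
        mul_le_mul_left (enorm_integral_le_lintegral_enorm _) _
    _ = ∫⁻ u in uIoc t θ, ‖slopeNoise f φ n t u y‖ₑ * ENNReal.ofReal ((2 * (θ - t) ^ 2)⁻¹) := by
        rw [lintegral_mul_const _ (measurable_slopeNoise_left n t y).enorm]
    _ ≤ ∫⁻ u in uIoc t θ, ‖slopeNoise f φ n t u y‖ₑ *
          ENNReal.ofReal (((u - t) ^ 2 + a ^ 2)⁻¹) :=
        setLIntegral_mono' measurableSet_uIoc fun u hu =>
          mul_le_mul_right (ENNReal.ofReal_le_ofReal (hw u hu)) _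
    _ ≤ weightedNoise f φ n t a y := setLIntegral_le_lintegral _ _

theorem rankCriterion_sub_shift (hf : IsTemplate f) {n : ℕ} (y : Fin n → ℝ) (θ : ℝ) (k : ℤ) :
    rankCriterion f y (θ - k) = rankCriterion f y θ := by
  unfold rankCriterion
  refine Finset.sum_congr rfl fun i _ => ?_
  have h1 : designPoint n i - (θ - k) = designPoint n i - θ + k * 1 := by ring
  rw [h1, hf.periodic.int_mul k]

theorem mean_rank_eq {n : ℕ} (y : Fin n → ℝ) (t θ : ℝ) :
    ((n : ℝ)⁻¹) ^ 2 * (rankCriterion f y θ - rankCriterion f y t)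
      = (n : ℝ)⁻¹ * ∑ i, (f (designPoint n i - θ) - f (designPoint n i - t)) *
          centredRank f φ n t i y
        + (n : ℝ)⁻¹ * ∑ i, (f (designPoint n i - θ) - f (designPoint n i - t)) *
          ((n : ℝ)⁻¹ * ∑ j, pairProb f φ n t i j) := by
  rw [rankCriterion, rankCriterion, ← Finset.sum_sub_distrib, ← mul_add, ← Finset.sum_add_distrib,
    sq, mul_assoc, Finset.mul_sum _ _ ((n : ℝ)⁻¹)]
  congr 1
  refine Finset.sum_congr rfl fun i _ => ?_
  rw [rank_eq_sum, centredRank, Finset.sum_sub_distrib]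
  ring

/-- R-estimators converge at rate `√n`, uniformly in the shift. -/
theorem attainsRate_of_isREstimator (hf : IsTemplate f) (hφ : IsNoiseDensity φ)
    (hM : TrueShiftIsUniqueMax f φ) {est : Estimator} (hest : IsREstimator f est) :
    AttainsRate f φ (fun n => √n) est := by
  intro ε hε
  obtain ⟨L, hL⟩ := hf.lipschitz
  obtain ⟨c, hc, hcurv⟩ := exists_crossCorr_sq_le hf hφ hM
  obtain ⟨C₁, hC₁, hmean⟩ := exists_mean_score_le hf hφ
  set B := (4 * (L : ℝ) ^ 2 + 1) * Real.pi
  have hB : 0 < B := by positivity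
  -- The bound 2C₁/c, with K ≤ K², lets half of the quadratic drop absorb the bias C₁/n. The bound
  -- 4B/(cε) makes the final Markov estimate 4B/(cK) at most ε.
  set K := max (max 1 (2 * C₁ / c)) (4 * B / (c * ε))
  have hK1 : 1 ≤ K := (le_max_left _ _).trans (le_max_left _ _)
  have hK2 : 2 * C₁ ≤ c * K ^ 2 := by
    have h1 : 2 * C₁ / c ≤ K := (le_max_right _ _).trans (le_max_left _ _)
    rw [div_le_iff₀ hc] at h1
    nlinarith
  have hK3 : 4 * B ≤ c * ε * K := by
    have h1 : 4 * B / (c * ε) ≤ K := le_max_right _ _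
    rwa [div_le_iff₀' (by positivity)] at h1
  have hK0 : 0 < K := by linarith
  refine ⟨K, fun n hn t => ?_⟩
  have hn0 : (0 : ℝ) < n := by exact_mod_cast hn
  have hs : 0 < √(n : ℝ) := Real.sqrt_pos.2 hn0
  have hss : √(n : ℝ) ^ 2 = n := Real.sq_sqrt hn0.le
  -- The bounding event is measurable and does not involve the estimator, so any choice of
  -- maximizers is covered, measurable or not.
  have hsub : {y | K < √n * shiftDist (est n y) t}
      ⊆ {y | ENNReal.ofReal (c / 4) ≤ weightedNoise f φ n t (K / √n) y} := by
    intro y hy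
    have hy' : K < √n * shiftDist (est n y) t := hy
    -- The representative of the estimate nearest to t. It is still a maximizer by periodicity, and
    -- it lies in the range |θ - t| ≤ 1/2 of the curvature bound.
    set θ := est n y - round (est n y - t)
    have hd : shiftDist (est n y) t = |θ - t| := by
      rw [shiftDist, sub_right_comm]
    have hd2 : |θ - t| ≤ 1 / 2 := by
      rw [← hd]; exact abs_sub_round _
    rw [hd] at hy'
    have had : K / √n < |θ - t| := by rwa [div_lt_iff₀' hs]
    have hmax : rankCriterion f y t ≤ rankCriterion f y θ := by
      rw [rankCriterion_sub_shift hf]; exact hest n y t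
    have h1 := mean_rank_eq (f := f) (φ := φ) y t θ
    have h2 : 0 ≤ ((n : ℝ)⁻¹) ^ 2 * (rankCriterion f y θ - rankCriterion f y t) :=
      mul_nonneg (by positivity) (sub_nonneg.2 hmax)
    have h3 := hmean n hn t θ (pairProb f φ n t) (pairProb_mem_Icc hφ n t)
      fun i j hij => integral_rankIndicator hφ n t hij
    have h4 := hcurv (θ - t) hd2
    have h5 : C₁ / n ≤ c / 2 * (θ - t) ^ 2 := by
      have h6 : K ^ 2 ≤ n * (θ - t) ^ 2 := by
        have := pow_le_pow_left₀ hK0.le hy'.le 2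
        rwa [mul_pow, hss, sq_abs] at this
      rw [div_le_iff₀ hn0]
      have := mul_le_mul_of_nonneg_left h6 hc.le
      linarith
    have h7 := le_weightedNoise (φ := φ) hL n t θ y (a := K / √n) (c := c / 2) (by positivity)
      had.le (by linarith)
    rwa [div_div, show (2 : ℝ) * 2 = 4 by norm_num] at h7
  refine (measure_mono hsub).trans ((meas_ge_le_lintegral_div
    (measurable_weightedNoise n t _).aemeasurable
    (by simpa using hc) ENNReal.ofReal_ne_top).trans ?_)
  refine (ENNReal.div_le_div_right (lintegral_weightedNoise_le hφ hL hn t (by positivity)) _).trans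
    ?_
  rw [← ENNReal.ofReal_div_of_pos (by positivity)]
  refine ENNReal.ofReal_le_ofReal ?_
  have h8 : (4 * (L : ℝ) ^ 2 + 1) / √n * (Real.pi / (K / √n)) / (c / 4) = 4 * B / (c * K) := by
    simp only [B]
    field_simp
  rw [h8, div_le_iff₀ (by positivity)]
  linarith

end

/-! ### Fisher information and Hellinger affinity of shifts -/

theorem absolutelyContinuousOnInterval_of_dist_le {f g : ℝ → ℝ} {a b K : ℝ} (hK : 0 ≤ K)
    (hf : AbsolutelyContinuousOnInterval f a b)
    (hg : ∀ x y, dist (g x) (g y) ≤ K * dist (f x) (f y)) :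
    AbsolutelyContinuousOnInterval g a b := by
  rw [absolutelyContinuousOnInterval_iff] at hf ⊢
  intro ε hε
  obtain ⟨δ, hδ, h⟩ := hf (ε / (K + 1)) (by positivity)
  refine ⟨δ, hδ, fun E hE hlen => ?_⟩
  have h1 := h E hE hlen
  rw [lt_div_iff₀ (by positivity)] at h1
  have h2 : 0 ≤ ∑ i ∈ Finset.range E.1, dist (f (E.2 i).1) (f (E.2 i).2) :=
    Finset.sum_nonneg fun _ _ => dist_nonneg
  have h3 : ∑ i ∈ Finset.range E.1, dist (g (E.2 i).1) (g (E.2 i).2)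
      ≤ K * ∑ i ∈ Finset.range E.1, dist (f (E.2 i).1) (f (E.2 i).2) := by
    rw [Finset.mul_sum]
    exact Finset.sum_le_sum fun i _ => hg _ _
  nlinarith

theorem dist_sqrt_add_le {a b ε : ℝ} (ha : 0 ≤ a) (hb : 0 ≤ b) (hε : 0 < ε) :
    dist √(a + ε) √(b + ε) ≤ (√ε)⁻¹ * dist a b := by
  have h0 : 0 < √ε := Real.sqrt_pos.2 hε
  have h1 : √ε ≤ √(a + ε) := Real.sqrt_le_sqrt (by linarith)
  have h2 := Real.sqrt_nonneg (b + ε)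
  have h3 : (√(a + ε) - √(b + ε)) * (√(a + ε) + √(b + ε)) = a - b := by
    have h4 := Real.mul_self_sqrt (show 0 ≤ a + ε by linarith)
    have h5 := Real.mul_self_sqrt (show 0 ≤ b + ε by linarith)
    linear_combination h4 - h5
  rw [Real.dist_eq, Real.dist_eq, ← h3, abs_mul, inv_mul_eq_div, le_div_iff₀ h0]
  refine mul_le_mul_of_nonneg_left ?_ (abs_nonneg _)
  rw [abs_of_nonneg (by linarith)]
  linarith

theorem sq_integral_le_mul_integral_sq {g : ℝ → ℝ} {a b : ℝ} (hab : a < b)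
    (hg : IntervalIntegrable g volume a b) (hg2 : IntervalIntegrable (fun x => g x ^ 2) volume a b) :
    (∫ x in a..b, g x) ^ 2 ≤ (b - a) * ∫ x in a..b, g x ^ 2 := by
  set D := ∫ x in a..b, g x with hD
  set m := D / (b - a)
  have hba : 0 < b - a := sub_pos.2 hab
  have h0 : 0 ≤ ∫ x in a..b, (g x - m) ^ 2 :=
    intervalIntegral.integral_nonneg hab.le fun _ _ => sq_nonneg _
  have h1 : ∫ x in a..b, (g x - m) ^ 2 = (∫ x in a..b, g x ^ 2) - 2 * m * D + m ^ 2 * (b - a) := by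
    have : ∀ x, (g x - m) ^ 2 = g x ^ 2 - 2 * m * g x + m ^ 2 := fun x => by ring
    simp only [this]
    rw [intervalIntegral.integral_add (hg2.sub (hg.const_mul _)) intervalIntegrable_const,
      intervalIntegral.integral_sub hg2 (hg.const_mul _), intervalIntegral.integral_const_mul,
      intervalIntegral.integral_const, smul_eq_mul, ← hD]
    ring
  have h2 : (b - a) * ((∫ x in a..b, g x ^ 2) - 2 * m * D + m ^ 2 * (b - a))
      = (b - a) * (∫ x in a..b, g x ^ 2) - D ^ 2 := by
    simp only [m]
    field_simp
    ring
  rw [h1] at h0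
  have := mul_nonneg hba.le h0
  linarith

section Fisher

variable {φ : ℝ → ℝ}

/-- At a zero of φ, a minimum, the derivative vanishes and both sides are 0. This is where the
convention 0/0 = 0 is harmless. -/
theorem deriv_sqrt_add_sq_le (hφ : IsNoiseDensity φ) {ε : ℝ} (hε : 0 < ε) {x : ℝ}
    (hx : DifferentiableAt ℝ φ x) :
    deriv (fun x => √(φ x + ε)) x ^ 2 ≤ deriv φ x ^ 2 / φ x / 4 := by
  have hp : 0 < φ x + ε := add_pos_of_nonneg_of_pos (hφ.nonneg x) hε
  rw [((hx.hasDerivAt.add_const ε).sqrt hp.ne').deriv, div_pow, mul_pow, Real.sq_sqrt hp.le]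
  rcases (hφ.nonneg x).eq_or_lt with h | h
  · have hmin : IsLocalMin φ x := Eventually.of_forall fun z => by
      rw [← h]; exact hφ.nonneg z
    rw [hmin.deriv_eq_zero]
    simp
  · rw [div_div]
    exact div_le_div_of_nonneg_left (sq_nonneg _) (by positivity) (by linarith)

/-- The square root is not Lipschitz at 0, so absolute continuity does not pass directly to √φ. It
does pass to √(φ + ε), to which the fundamental theorem and Cauchy–Schwarz apply with a bound free
of ε; then ε tends to 0. -/
theorem sq_sqrt_sub_sqrt_le (hφ : IsNoiseDensity φ) (hI : HasFiniteFisherInformation φ)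
    {a b : ℝ} (hab : a < b) :
    (√(φ b) - √(φ a)) ^ 2 ≤ (b - a) * ∫ x in a..b, deriv φ x ^ 2 / φ x / 4 := by
  have hψ : IntervalIntegrable (fun x => deriv φ x ^ 2 / φ x / 4) volume a b :=
    (hI.2.div_const 4).intervalIntegrable
  have hle : ∀ ε > 0, (√(φ b + ε) - √(φ a + ε)) ^ 2
      ≤ (b - a) * ∫ x in a..b, deriv φ x ^ 2 / φ x / 4 := fun ε hε => by
    have hac : AbsolutelyContinuousOnInterval (fun x => √(φ x + ε)) a b :=
      absolutelyContinuousOnInterval_of_dist_le (by positivity) (hI.1 a b)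
        fun x y => dist_sqrt_add_le (hφ.nonneg x) (hφ.nonneg y) hε
    have hae : ∀ᵐ x, x ∈ uIcc a b →
        deriv (fun x => √(φ x + ε)) x ^ 2 ≤ deriv φ x ^ 2 / φ x / 4 := by
      filter_upwards [(hI.1 a b).ae_differentiableAt] with x hx hxab
      exact deriv_sqrt_add_sq_le hφ hε (hx hxab)
    have hg2 : IntervalIntegrable (fun x => deriv (fun x => √(φ x + ε)) x ^ 2) volume a b := by
      refine hψ.mono_fun ((measurable_deriv _).pow_const 2).aestronglyMeasurable
        ((ae_restrict_iff' measurableSet_uIoc).2 ?_)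
      filter_upwards [hae] with x hx hxab
      rw [Real.norm_of_nonneg (sq_nonneg _)]
      exact (hx (uIoc_subset_uIcc hxab)).trans (le_abs_self _)
    rw [← hac.integral_deriv_eq_sub]
    refine (sq_integral_le_mul_integral_sq hab hac.intervalIntegrable_deriv hg2).trans ?_
    refine mul_le_mul_of_nonneg_left ?_ (sub_nonneg.2 hab.le)
    refine intervalIntegral.integral_mono_ae_restrict hab.le hg2 hψ
      ((ae_restrict_iff' measurableSet_Icc).2 ?_)
    filter_upwards [hae] with x hx hxab
    exact hx (by rwa [uIcc_of_le hab.le])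
  have hcont : Tendsto (fun ε => (√(φ b + ε) - √(φ a + ε)) ^ 2) (𝓝[>] 0)
      (𝓝 ((√(φ b + 0) - √(φ a + 0)) ^ 2)) :=
    ((by fun_prop : Continuous fun ε => (√(φ b + ε) - √(φ a + ε)) ^ 2).tendsto 0).mono_left
      nhdsWithin_le_nhds
  simp only [add_zero] at hcont
  exact le_of_tendsto hcont (by filter_upwards [self_mem_nhdsWithin] with ε hε using hle ε hε)

/-- Integrate the pointwise bound in x. By Tonelli and translation invariance each w in (0, s]
contributes the same total, which produces the second factor s. -/
theorem integral_sq_sqrt_sub_sqrt_le_of_pos (hφ : IsNoiseDensity φ)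
    (hI : HasFiniteFisherInformation φ) {s : ℝ} (hs : 0 < s) :
    ∫ x, (√(φ (x + s)) - √(φ x)) ^ 2 ≤ s ^ 2 * ((∫ x, deriv φ x ^ 2 / φ x) / 4) := by
  set ψ : ℝ → ℝ := fun x => deriv φ x ^ 2 / φ x / 4 with hψ
  have hψi : Integrable ψ := hI.2.div_const 4
  have hψ0 : ∀ x, 0 ≤ ψ x := fun x => by have := hφ.nonneg x; positivity
  have hψm : Measurable ψ :=
    (((measurable_deriv φ).pow_const 2).div hφ.measurable).div_const 4
  have hJ : ∫ x, ψ x = (∫ x, deriv φ x ^ 2 / φ x) / 4 := integral_div 4 _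
  rw [← hJ, integral_eq_lintegral_of_nonneg_ae (Eventually.of_forall fun x => sq_nonneg _)]
  swap
  · exact (((hφ.measurable.comp (measurable_add_const s)).sqrt.sub
      hφ.measurable.sqrt).pow_const 2).aestronglyMeasurable
  refine ENNReal.toReal_le_of_le_ofReal
    (mul_nonneg (sq_nonneg s) (integral_nonneg hψ0)) ?_
  have hpt : ∀ x, ENNReal.ofReal ((√(φ (x + s)) - √(φ x)) ^ 2)
      ≤ ENNReal.ofReal s * ∫⁻ w in Ioc 0 s, ENNReal.ofReal (ψ (x + w)) := fun x => by
    have h1 := sq_sqrt_sub_sqrt_le hφ hI (show x < x + s by linarith)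
    have h2 : ∫ y in x..x + s, ψ y = ∫ w in Ioc 0 s, ψ (x + w) := by
      rw [← intervalIntegral.integral_of_le hs.le, intervalIntegral.integral_comp_add_left ψ x,
        add_zero]
    rw [add_sub_cancel_left, ← hψ, h2] at h1
    rw [← ofReal_integral_eq_lintegral_ofReal (hψi.comp_add_left x).integrableOn
      (Eventually.of_forall fun w => hψ0 _), ← ENNReal.ofReal_mul hs.le]
    exact ENNReal.ofReal_le_ofReal h1
  have hm2 : Measurable fun q : ℝ × ℝ => ENNReal.ofReal (ψ (q.1 + q.2)) :=
    (hψm.comp (measurable_fst.add measurable_snd)).ennreal_ofReal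
  calc ∫⁻ x, ENNReal.ofReal ((√(φ (x + s)) - √(φ x)) ^ 2)
      ≤ ∫⁻ x, ENNReal.ofReal s * ∫⁻ w in Ioc 0 s, ENNReal.ofReal (ψ (x + w)) :=
        lintegral_mono hpt
    _ = ENNReal.ofReal s * ∫⁻ w in Ioc 0 s, ∫⁻ x, ENNReal.ofReal (ψ (x + w)) := by
        rw [lintegral_const_mul _ hm2.lintegral_prod_right', lintegral_lintegral_swap]
        exact hm2.aemeasurable
    _ = ENNReal.ofReal s * ∫⁻ w in Ioc 0 s, ENNReal.ofReal (∫ x, ψ x) := by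
        congr 1
        refine lintegral_congr fun w => ?_
        rw [lintegral_add_right_eq_self (fun x => ENNReal.ofReal (ψ x)) w,
          ofReal_integral_eq_lintegral_ofReal hψi (Eventually.of_forall hψ0)]
    _ = ENNReal.ofReal (s ^ 2 * ∫ x, ψ x) := by
        rw [lintegral_const, Measure.restrict_apply_univ, Real.volume_Ioc, sub_zero,
          ← ENNReal.ofReal_mul (integral_nonneg hψ0), ← ENNReal.ofReal_mul hs.le]
        congr 1
        ring

theorem integral_sq_sqrt_sub_sqrt_le (hφ : IsNoiseDensity φ)
    (hI : HasFiniteFisherInformation φ) (a b : ℝ) :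
    ∫ x, (√(φ (x - a)) - √(φ (x - b))) ^ 2
      ≤ (a - b) ^ 2 * ((∫ x, deriv φ x ^ 2 / φ x) / 4) := by
  wlog hab : b ≤ a generalizing a b
  · have := this b a (le_of_not_ge hab)
    simp only [sub_sq_comm (√(φ (_ - b)))] at this
    rwa [sub_sq_comm b a] at this
  rcases hab.eq_or_lt with rfl | hlt
  · simp
  · have h := integral_sq_sqrt_sub_sqrt_le_of_pos hφ hI (sub_pos.2 hlt)
    rw [← integral_sub_right_eq_self (fun x => (√(φ (x + (a - b))) - √(φ x)) ^ 2) a] at h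
    simp only [sub_add_sub_cancel] at h
    simp only [sub_sq_comm (√(φ (_ - a)))]
    exact h

theorem integrable_shift (hφ : IsNoiseDensity φ) (a : ℝ) : Integrable fun x => φ (x - a) :=
  hφ.integrable.comp_sub_right a

theorem measurable_sqrt_shift (hφ : IsNoiseDensity φ) (a : ℝ) :
    Measurable fun x => √(φ (x - a)) :=
  (hφ.measurable.comp (measurable_sub_const a)).sqrt

theorem integral_shift (hφ : IsNoiseDensity φ) (a : ℝ) : ∫ x, φ (x - a) = 1 := by
  rw [integral_sub_right_eq_self φ a, hφ.integral_eq_one]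

theorem integrable_sqrt_mul_sqrt (hφ : IsNoiseDensity φ) (a b : ℝ) :
    Integrable fun x => √(φ (x - a)) * √(φ (x - b)) := by
  refine ((integrable_shift hφ a).add (integrable_shift hφ b)).mono'
    ((measurable_sqrt_shift hφ a).mul (measurable_sqrt_shift hφ b)).aestronglyMeasurable
    (Eventually.of_forall fun x => ?_)
  rw [Real.norm_of_nonneg (by positivity), Pi.add_apply]
  nlinarith [Real.sq_sqrt (hφ.nonneg (x - a)), Real.sq_sqrt (hφ.nonneg (x - b)),
    sq_nonneg (√(φ (x - a)) - √(φ (x - b))), hφ.nonneg (x - a), hφ.nonneg (x - b)]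

/-- A lower bound for the Hellinger affinity of two shifts of the noise. -/
theorem le_integral_sqrt_mul_sqrt (hφ : IsNoiseDensity φ) (hI : HasFiniteFisherInformation φ)
    (a b : ℝ) :
    1 - (a - b) ^ 2 * ((∫ x, deriv φ x ^ 2 / φ x) / 8) ≤ ∫ x, √(φ (x - a)) * √(φ (x - b)) := by
  have h1 : ∫ x, (√(φ (x - a)) - √(φ (x - b))) ^ 2
      = 2 - 2 * ∫ x, √(φ (x - a)) * √(φ (x - b)) := by
    have : ∀ x, (√(φ (x - a)) - √(φ (x - b))) ^ 2
        = φ (x - a) + φ (x - b) - 2 * (√(φ (x - a)) * √(φ (x - b))) := fun x => by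
      rw [sub_sq, Real.sq_sqrt (hφ.nonneg _), Real.sq_sqrt (hφ.nonneg _)]
      ring
    have hadd : Integrable fun x => φ (x - a) + φ (x - b) :=
      (integrable_shift hφ a).add (integrable_shift hφ b)
    simp only [this]
    rw [integral_sub hadd
      ((integrable_sqrt_mul_sqrt hφ a b).const_mul 2),
      integral_add (integrable_shift hφ a) (integrable_shift hφ b), integral_const_mul,
      integral_shift hφ, integral_shift hφ]
    ring
  have h2 := integral_sq_sqrt_sub_sqrt_le hφ hI a b
  linarith

end Fisher

/-! ### Two-point lower bound -/

/-- Le Cam's two-point inequality, with root densities `u` and `v`. -/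
theorem integral_mul_le_of_sq {Ω : Type*} [MeasurableSpace Ω] {μ : Measure Ω} {u v : Ω → ℝ}
    (huv : Integrable (fun x => u x * v x) μ)
    (hu : Integrable (fun x => u x ^ 2) μ) (hv : Integrable (fun x => v x ^ 2) μ)
    (hu1 : ∫ x, u x ^ 2 ∂μ = 1) (hv1 : ∫ x, v x ^ 2 ∂μ = 1) {B : Set Ω} (hB : MeasurableSet B) :
    ∫ x, u x * v x ∂μ ≤ 2 * ∫ x in B, u x ^ 2 ∂μ + 2 * ∫ x in Bᶜ, v x ^ 2 ∂μ + 1 / 4 := by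
  -- The unbalanced inequality uv ≤ 2u² + v²/8 puts the small coefficient on the density whose mass
  -- on the set is only known to be at most 1. The two leftovers 1/8 add up to 1/4.
  have h1 : ∫ x in B, u x * v x ∂μ ≤ 2 * ∫ x in B, u x ^ 2 ∂μ + (∫ x in B, v x ^ 2 ∂μ) / 8 := by
    rw [← integral_const_mul, ← integral_div,
      ← integral_add (hu.integrableOn.const_mul 2) (hv.integrableOn.div_const 8)]
    refine integral_mono huv.integrableOn
      ((hu.integrableOn.const_mul 2).add (hv.integrableOn.div_const 8)) fun x => ?_
    simp only
    nlinarith [sq_nonneg (4 * u x - v x)]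
  have h2 : ∫ x in Bᶜ, u x * v x ∂μ
      ≤ (∫ x in Bᶜ, u x ^ 2 ∂μ) / 8 + 2 * ∫ x in Bᶜ, v x ^ 2 ∂μ := by
    rw [← integral_const_mul, ← integral_div,
      ← integral_add (hu.integrableOn.div_const 8) (hv.integrableOn.const_mul 2)]
    refine integral_mono huv.integrableOn
      ((hu.integrableOn.div_const 8).add (hv.integrableOn.const_mul 2)) fun x => ?_
    simp only
    nlinarith [sq_nonneg (u x - 4 * v x)]
  have h3 : ∫ x in B, v x ^ 2 ∂μ ≤ 1 := by
    rw [← hv1]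
    exact setIntegral_le_integral hv (Eventually.of_forall fun _ => sq_nonneg _)
  have h4 : ∫ x in Bᶜ, u x ^ 2 ∂μ ≤ 1 := by
    rw [← hu1]
    exact setIntegral_le_integral hu (Eventually.of_forall fun _ => sq_nonneg _)
  rw [← integral_add_compl hB huv]
  linarith

section

variable {f φ : ℝ → ℝ}

theorem shiftedLaw_eq_withDensity (hφ : IsNoiseDensity φ) (a : ℝ) :
    shiftedLaw φ a = volume.withDensity fun y => ENNReal.ofReal (φ (y - a)) := by
  have hm : Measurable fun y => ENNReal.ofReal (φ (y - a)) :=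
    (hφ.measurable.comp (measurable_sub_const a)).ennreal_ofReal
  ext s hs
  have hs' : MeasurableSet ((a + ·) ⁻¹' s) := measurable_const_add a hs
  rw [shiftedLaw, Measure.map_apply (measurable_const_add a) hs, noiseLaw,
    withDensity_apply _ hs', withDensity_apply _ hs,
    ← (measurePreserving_add_left volume a).setLIntegral_comp_preimage hs hm]
  simp only [add_sub_cancel_left]

/-- The square root of the density of a sample with signal vector `a`. -/
def rootDensity (φ : ℝ → ℝ) {n : ℕ} (a y : Fin n → ℝ) : ℝ := ∏ i, √(φ (y i - a i))

theorem rootDensity_sq (hφ : IsNoiseDensity φ) {n : ℕ} (a y : Fin n → ℝ) :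
    rootDensity φ a y ^ 2 = ∏ i, φ (y i - a i) := by
  rw [rootDensity, ← Finset.prod_pow]
  exact Finset.prod_congr rfl fun i _ => Real.sq_sqrt (hφ.nonneg _)

theorem integrable_rootDensity_sq (hφ : IsNoiseDensity φ) {n : ℕ} (a : Fin n → ℝ) :
    Integrable fun y => rootDensity φ a y ^ 2 := by
  simp only [rootDensity_sq hφ]
  exact Integrable.fintype_prod (f := fun i x => φ (x - a i)) fun i => integrable_shift hφ (a i)

theorem integrable_rootDensity_mul (hφ : IsNoiseDensity φ) {n : ℕ} (a b : Fin n → ℝ) :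
    Integrable fun y => rootDensity φ a y * rootDensity φ b y := by
  simp only [rootDensity, ← Finset.prod_mul_distrib]
  exact Integrable.fintype_prod (f := fun i x => √(φ (x - a i)) * √(φ (x - b i)))
    fun i => integrable_sqrt_mul_sqrt hφ (a i) (b i)

theorem integral_rootDensity_mul {n : ℕ} (a b : Fin n → ℝ) :
    ∫ y, rootDensity φ a y * rootDensity φ b y
      = ∏ i, ∫ x, √(φ (x - a i)) * √(φ (x - b i)) := by
  simp only [rootDensity, ← Finset.prod_mul_distrib]
  exact integral_fintype_prod_volume_eq_prod fun i x => √(φ (x - a i)) * √(φ (x - b i))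

theorem integral_rootDensity_sq (hφ : IsNoiseDensity φ) {n : ℕ} (a : Fin n → ℝ) :
    ∫ y, rootDensity φ a y ^ 2 = 1 := by
  simp only [rootDensity_sq hφ]
  rw [integral_fintype_prod_volume_eq_prod fun i x => φ (x - a i)]
  simp only [integral_shift hφ, Finset.prod_const_one]

theorem pi_shiftedLaw_eq_withDensity (hφ : IsNoiseDensity φ) {n : ℕ} (a : Fin n → ℝ) :
    Measure.pi (fun i => shiftedLaw φ (a i))
      = volume.withDensity fun y => ENNReal.ofReal (rootDensity φ a y ^ 2) := by
  have := fun i => isProbabilityMeasure_shiftedLaw hφ (a i)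
  refine Measure.pi_eq fun s hs => ?_
  rw [withDensity_apply _ (MeasurableSet.univ_pi hs), ← ofReal_integral_eq_lintegral_ofReal
    (integrable_rootDensity_sq hφ a).integrableOn (Eventually.of_forall fun _ => sq_nonneg _),
    volume_pi, Measure.restrict_pi_pi]
  simp only [rootDensity_sq hφ]
  rw [integral_fintype_prod_eq_prod fun i x => φ (x - a i),
    ENNReal.ofReal_prod_of_nonneg fun i _ => integral_nonneg fun x => hφ.nonneg _]
  refine Finset.prod_congr rfl fun i _ => ?_
  rw [shiftedLaw_eq_withDensity hφ, withDensity_apply _ (hs i),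
    ofReal_integral_eq_lintegral_ofReal (integrable_shift hφ _).integrableOn
      (Eventually.of_forall fun x => hφ.nonneg _)]

theorem sampleLaw_apply (hφ : IsNoiseDensity φ) (n : ℕ) (θ : ℝ) {B : Set (Fin n → ℝ)}
    (hB : MeasurableSet B) :
    sampleLaw f φ n θ B = ENNReal.ofReal
      (∫ y in B, rootDensity φ (fun i => f (designPoint n i - θ)) y ^ 2) := by
  rw [sampleLaw_eq_pi hφ, pi_shiftedLaw_eq_withDensity hφ (fun i => f (designPoint n i - θ)),
    withDensity_apply _ hB, ofReal_integral_eq_lintegral_ofReal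
      (integrable_rootDensity_sq hφ _).integrableOn (Eventually.of_forall fun _ => sq_nonneg _)]

/-- The affinity is a product over the observations, each factor at least 1 - x with nx ≤ 1/2 by the
condition on D, so Bernoulli's inequality gives the bound. -/
theorem half_le_integral_rootDensity_mul (hφ : IsNoiseDensity φ)
    (hI : HasFiniteFisherInformation φ) {n : ℕ} (hn : 1 ≤ n) {a b : Fin n → ℝ} {D : ℝ}
    (hab : ∀ i, (a i - b i) ^ 2 ≤ D / n) (hD : D * (∫ x, deriv φ x ^ 2 / φ x) ≤ 4) :
    1 / 2 ≤ ∫ y, rootDensity φ a y * rootDensity φ b y := by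
  set I := ∫ x, deriv φ x ^ 2 / φ x
  have hI0 : 0 ≤ I := integral_nonneg fun x => div_nonneg (sq_nonneg _) (hφ.nonneg x)
  have hn0 : (1 : ℝ) ≤ n := by exact_mod_cast hn
  set x : ℝ := D * I / 8 / n
  have hx : x ≤ 1 / 2 := by
    rw [div_le_iff₀ (by positivity)]
    linarith
  have hlow : ∀ i, 1 - x ≤ ∫ z, √(φ (z - a i)) * √(φ (z - b i)) := fun i => by
    refine le_trans ?_ (le_integral_sqrt_mul_sqrt hφ hI (a i) (b i))
    have h1 := mul_le_mul_of_nonneg_right (hab i) (div_nonneg hI0 (show (0 : ℝ) ≤ 8 by norm_num))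
    have h2 : D / n * (I / 8) = x := by simp only [x]; field_simp
    linarith
  rw [integral_rootDensity_mul]
  calc 1 / 2 ≤ 1 + (n : ℝ) * (-x) := by
        have : (n : ℝ) * x = D * I / 8 := by simp only [x]; field_simp
        linarith
    _ ≤ (1 + -x) ^ n := one_add_mul_le_pow (by linarith) n
    _ = ∏ _i : Fin n, (1 - x) := by
        rw [Finset.prod_const, Finset.card_univ, Fintype.card_fin, sub_eq_add_neg]
    _ ≤ ∏ i, ∫ z, √(φ (z - a i)) * √(φ (z - b i)) :=
        Finset.prod_le_prod (fun i _ => by linarith) fun i _ => hlow i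

theorem shiftDist_eq_norm (θ θ' : ℝ) : shiftDist θ θ' = ‖((θ - θ' : ℝ) : UnitAddCircle)‖ :=
  UnitAddCircle.norm_eq.symm

theorem shiftDist_comm (θ θ' : ℝ) : shiftDist θ θ' = shiftDist θ' θ := by
  rw [shiftDist_eq_norm, shiftDist_eq_norm, ← norm_neg, ← AddCircle.coe_neg, neg_sub]

theorem shiftDist_triangle (θ₁ θ₂ θ₃ : ℝ) :
    shiftDist θ₁ θ₃ ≤ shiftDist θ₁ θ₂ + shiftDist θ₂ θ₃ := by
  rw [shiftDist_eq_norm, shiftDist_eq_norm, shiftDist_eq_norm, ← sub_add_sub_cancel θ₁ θ₂ θ₃,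
    AddCircle.coe_add]
  exact norm_add_le _ _

theorem shiftDist_zero_right {α : ℝ} (h0 : 0 ≤ α) (h1 : α < 1 / 2) : shiftDist α 0 = α := by
  have : round α = 0 := round_eq_zero_iff.2 ⟨by linarith, h1⟩
  rw [shiftDist, sub_zero, this, Int.cast_zero, sub_zero, abs_of_nonneg h0]

/-- Two shifts whose samples have a large affinity cannot both be estimated well. -/
theorem exists_shift_of_affinity (hφ : IsNoiseDensity φ) {n : ℕ} {θ₀ θ₁ : ℝ}
    (haff : 1 / 2 ≤ ∫ y, rootDensity φ (fun i => f (designPoint n i - θ₀)) y *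
      rootDensity φ (fun i : Fin n => f (designPoint n i - θ₁)) y)
    {A₀ A₁ : Set (Fin n → ℝ)} (hA : A₀ᶜ ⊆ A₁) :
    ENNReal.ofReal (1 / 16) ≤ sampleLaw f φ n θ₀ A₀ ∨
      ENNReal.ofReal (1 / 16) ≤ sampleLaw f φ n θ₁ A₁ := by
  by_contra! h
  obtain ⟨h₀, h₁⟩ := h
  -- The estimator need not be measurable. A measurable hull has the same measure as A₀, and its
  -- complement still lies in A₁. Two probabilities below 1/16 would then force the affinity below
  -- 4/16 + 1/4 = 1/2.
  set B := toMeasurable (sampleLaw f φ n θ₀) A₀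
  have hB : MeasurableSet B := measurableSet_toMeasurable _ _
  have hBA : Bᶜ ⊆ A₁ := (compl_subset_compl.2 (subset_toMeasurable _ _)).trans hA
  rw [← measure_toMeasurable, sampleLaw_apply hφ n θ₀ hB,
    ENNReal.ofReal_lt_ofReal_iff (by norm_num)] at h₀
  have h₁' := (measure_mono hBA).trans_lt h₁
  rw [sampleLaw_apply hφ n θ₁ hB.compl, ENNReal.ofReal_lt_ofReal_iff (by norm_num)] at h₁'
  have := integral_mul_le_of_sq (integrable_rootDensity_mul hφ _ _)
    (integrable_rootDensity_sq hφ fun i => f (designPoint n i - θ₀))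
    (integrable_rootDensity_sq hφ fun i => f (designPoint n i - θ₁))
    (integral_rootDensity_sq hφ _) (integral_rootDensity_sq hφ _) hB
  linarith

/-- With finite Fisher information, no estimator converges faster than `√n`. -/
theorem isMinimaxLowerRate_sqrt (hf : IsTemplate f) (hφ : IsNoiseDensity φ)
    (hI : HasFiniteFisherInformation φ) : IsMinimaxLowerRate f φ fun n => √n := by
  obtain ⟨L, hL⟩ := hf.lipschitz
  set I := ∫ x, deriv φ x ^ 2 / φ x with hIdef
  have hI0 : 0 ≤ I := integral_nonneg fun x => div_nonneg (sq_nonneg _) (hφ.nonneg x)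
  set Q := (L : ℝ) ^ 2 * I
  have hQ : 0 ≤ Q := by positivity
  -- Chosen so that α < 1/2, which keeps α/√n equal to its distance from 0 modulo 1, and so that α²Q
  -- ≤ 4, which is the affinity condition.
  set α := (3 + Q)⁻¹
  have hα : 0 < α := by positivity
  have hα1 : α * (3 + Q) = 1 := inv_mul_cancel₀ (by positivity)
  have hα2 : α < 1 / 2 := by nlinarith
  have hD : (L * α) ^ 2 * I ≤ 4 := by
    have : (L * α) ^ 2 * I = α * (α * Q) := by simp only [Q]; ring
    rw [this]
    nlinarith [mul_nonneg hα.le hQ]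
  refine ⟨α / 2, by positivity, 1 / 16, by norm_num, fun n hn T => ?_⟩
  have hn0 : (1 : ℝ) ≤ n := by exact_mod_cast hn
  have hs : 1 ≤ √(n : ℝ) := Real.one_le_sqrt.2 hn0
  have hs0 : 0 < √(n : ℝ) := by linarith
  have hss : √(n : ℝ) ^ 2 = n := Real.sq_sqrt (by linarith)
  have hdist : shiftDist (α / √n) 0 = α / √n :=
    shiftDist_zero_right (by positivity) ((div_le_self hα.le hs).trans_lt hα2)
  have haff := half_le_integral_rootDensity_mul hφ hI hn
    (a := fun i => f (designPoint n i - 0)) (b := fun i => f (designPoint n i - α / √n))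
    (D := (L * α) ^ 2) (fun i => by
      have h1 := hL.dist_le_mul (designPoint n i - 0) (designPoint n i - α / √n)
      rw [dist_sub_left, Real.dist_eq, Real.dist_eq, zero_sub, abs_neg,
        abs_of_nonneg (by positivity : 0 ≤ α / √n)] at h1
      have h2 := pow_le_pow_left₀ (abs_nonneg _) h1 2
      rw [sq_abs] at h2
      refine h2.trans_eq ?_
      rw [← mul_div_assoc, div_pow, hss]) hD
  -- The two shifts are α/√n apart, so an estimate closer than half of that to one is at least half
  -- of it away from the other.
  have hcover : {y | α / 2 ≤ √n * shiftDist (T y) 0}ᶜ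
      ⊆ {y | α / 2 ≤ √n * shiftDist (T y) (α / √n)} := fun y hy => by
    have h1 : √n * shiftDist (T y) 0 < α / 2 := not_le.1 hy
    have h2 := shiftDist_triangle (α / √n) (T y) 0
    rw [hdist, shiftDist_comm (α / √n), div_le_iff₀' hs0] at h2
    change α / 2 ≤ √n * shiftDist (T y) (α / √n)
    linarith
  rcases exists_shift_of_affinity hφ haff hcover with h | h
  · exact ⟨0, h⟩
  · exact ⟨_, h⟩

end

end TemplateMatching

end

theorem mainTheorem6 (f φ : ℝ → ℝ)
    (hf : TemplateMatching.IsTemplate f)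
    (hφ : TemplateMatching.IsNoiseDensity φ)
    (hM : TemplateMatching.TrueShiftIsUniqueMax f φ) :
    (∀ est : TemplateMatching.Estimator, TemplateMatching.IsREstimator f est →
      TemplateMatching.AttainsRate f φ (fun n => Real.sqrt n) est) ∧
    (TemplateMatching.HasFiniteFisherInformation φ →
      TemplateMatching.IsMinimaxLowerRate f φ (fun n => Real.sqrt n)) :=
  ⟨fun _ hest => TemplateMatching.attainsRate_of_isREstimator hf hφ hM hest,
    TemplateMatching.isMinimaxLowerRate_sqrt hf hφ⟩
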